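/- For complex variables $s_j=\sigma_j+it_j$ ($j=1,2,3$) let $$\zeta_{AV,2}(s_1,s_2,s_3)=\sum_{m=1}^\infty\sum_{1\le n<m}\frac{1}{m^{s_1}n^{s_2}(m+n)^{s_3}}\qquad(\sigma_1,\sigma_2,\sigma_3>1)$$ be the Apostol–Vu double zeta-function. This series converges, and the function extends analytically to the connected domain $\{\sigma_1+\sigma_3>0,\ \sigma_1+\sigma_2+\sigma_3>2,\ s_1+s_3\ne 1\}\subset\mathbb C^3$; the extension is denoted by the same symbol. **Theorem.** Let $\sigma_1\ge 0$, $\sigma_3>\max\{0,2-\sigma_1-\sigma_2\}$, $s_1+s_3\neq 1$, let $x,y$ be real with $y\ge x\ge 1$, and let $C>1$. Suppose that $|t_3|\le 2\pi x/C-|t_1|$, that either $t_1,t_3\ge 0$ or $t_1,t_3\le 0$, and that $(t_1,t_3)\ne(0,0)$. Then $$\begin{aligned} \zeta_{AV,2}(s_1,s_2,s_3)={}&\sum_{n\le x}\ \sum_{n<m\le y}\frac{1}{m^{s_1}n^{s_2}(m+n)^{s_3}} +\frac{y^{1-s_1}}{s_1+s_3-1}\sum_{n\le x}\frac{1}{n^{s_2}(y+n)^{s_3}}\\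 &+\frac{s_3}{s_1+s_3-1}\sum_{n\le x}\frac{1}{n^{s_2-1}}\int_y^\infty\frac{du}{u^{s_1}(u+n)^{s_3+1}} +\frac{2^{-s_3}}{s_1+s_3-1}\sum_{n>x}\frac{1}{n^{s_1+s_2+s_3-1}}\\ &+\frac{s_3}{s_1+s_3-1}\sum_{n>x}\frac{1}{n^{s_2-1}}\int_n^\infty\frac{du}{u^{s_1}(u+n)^{s_3+1}}+R, \end{aligned}$$ where all the series and integrals converge absolutely and $$R=\begin{cases} O\left(x^{-\sigma_1-\sigma_3}\right)&(\sigma_2>1),\\ O\left(x^{-\sigma_1-\sigma_3}(1+\log x)\right)&(\sigma_2=1),\\ O\left(x^{1-\sigma_1-\sigma_2-\sigma_3}\right)&(\sigma_2<1). \end{cases}$$ The implicit constants depend only on $s_1,s_2,\sigma_3$ and $C$; they do not depend on $t_3$, $x$ or $y$. -/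

import Mathlib

open Set MeasureTheory

noncomputable section

/-- The general term `1 / (m^{s₁} n^{s₂} (m+n)^{s₃})`. -/
def avTerm (s₁ s₂ s₃ : ℂ) (m n : ℕ) : ℂ :=
  1 / ((m : ℂ) ^ s₁ * (n : ℂ) ^ s₂ * ((m : ℂ) + (n : ℂ)) ^ s₃)

/-- The part `σ₁ + σ₃ > 0`, `σ₁ + σ₂ + σ₃ > 2`, `s₁ + s₃ ≠ 1` of `ℂ³`.
It is open, connected and contains the region where all real parts exceed `1`; of the possible
singular hyperplanes `s₁ + s₃ = 1 - l` and `s₁ + s₂ + s₃ = 2 - l` of the double zeta-function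
(`l` a natural number), it avoids them all. -/
def avDomain : Set (ℂ × ℂ × ℂ) :=
  {s | 0 < s.1.re + s.2.2.re ∧ 2 < s.1.re + s.2.1.re + s.2.2.re ∧ s.1 + s.2.2 ≠ 1}

/-- `F` is the analytic continuation to `avDomain` of the double series
`∑_m ∑_{1 ≤ n < m} 1 / (m^{s₁} n^{s₂} (m+n)^{s₃})`, which defines the Apostol-Vu double
zeta-function where `σ₁, σ₂, σ₃ > 1`. As `avDomain` is connected, two such `F` agree on it. -/
def IsAVContinuation (F : ℂ × ℂ × ℂ → ℂ) : Prop :=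
  DifferentiableOn ℂ F avDomain ∧
    ∀ s₁ s₂ s₃ : ℂ, 1 < s₁.re → 1 < s₂.re → 1 < s₃.re →
      HasSum (fun m : ℕ => ∑ n ∈ Finset.Ico 1 m, avTerm s₁ s₂ s₃ m n) (F (s₁, s₂, s₃))

open Classical in
/-- The Apostol-Vu double zeta-function, on `avDomain`: the analytic continuation of the double
series (the value `0` in the second branch is never used, since the continuation exists). -/
def zetaAV (s₁ s₂ s₃ : ℂ) : ℂ :=
  if h : ∃ F, IsAVContinuation F then h.choose (s₁, s₂, s₃) else 0

/-- The integrand `1 / (u^{s₁} (u+n)^{s₃+1})`. -/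
def avKernel (s₁ s₃ : ℂ) (n : ℕ) (u : ℝ) : ℂ :=
  1 / ((u : ℂ) ^ s₁ * ((u : ℂ) + (n : ℂ)) ^ (s₃ + 1))

/-- The tail integral `∫_a^∞ du / (u^{s₁} (u+n)^{s₃+1})`. -/
def avTail (s₁ s₃ : ℂ) (n : ℕ) (a : ℝ) : ℂ :=
  ∫ u in Ioi a, avKernel s₁ s₃ n u

/-- The size of the error term. In the case `σ₂ = 1` the logarithmic factor is `1 + log x`, which
for `x ≥ 2` is of the order of `log x`, and which does not vanish at `x = 1`. -/
def avError (σ₁ σ₂ σ₃ x : ℝ) : ℝ :=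
  if 1 < σ₂ then x ^ (-σ₁ - σ₃)
  else if σ₂ = 1 then x ^ (-σ₁ - σ₃) * (1 + Real.log x)
  else x ^ (1 - σ₁ - σ₂ - σ₃)

end

/-! For fixed `n`, put f(u) = u^(-s₁) (u+n)^(-s₃). Euler's summation formula turns the sum of f(m)
over m > c into the integral of f over (c, ∞) plus a remainder `kernRem`. One integration by parts
(`kernMain`) continues the integral to σ₁+σ₃ > 0 with the single pole s₁+s₃ = 1. The continued row
`avRow` is then n^(-s₂) times a quantity of order n^(1-σ₁-σ₃), so the rows are summable, locally
uniformly, once σ₁+σ₂+σ₃ > 2. Their sum is the continuation (`isAVContinuation_tsum_avRow`), which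
is unique (`IsAVContinuation.eqOn`).

The formula follows by starting Euler's formula at c = y in the rows n ≤ x and at c = n in the rows
n > x. The error is exactly the weighted sum of the remainders, so it suffices that each remainder
is O(|f(c)|) uniformly in t₃ (`exists_norm_kernRem_le`).

The remainder contains the integral of {u} f'(u), and bounding |f'| directly loses a factor |t₃|.
Write f' = (-α + iθ) f with real α, θ, where α ≥ 0 and |θ| ≤ 2π/C < 2π. For fixed θ the equation p'
+ iθp = iθv on [0,1] has a solution with p(0) = p(1), precisely because θ avoids the resonances ±2π.
Subtracting the derivative of p({u}, θ(u)) f(u) cancels the term iθ{u}f. What is left is of order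
α|f| + |θ'||f|: the first part is a multiple of the derivative of -|f|, and θ' has integral O(1).
Hence the total is O(|f(c)|) with a constant depending on C only. -/

open Filter Topology Metric

/-! ### Holomorphy of dominated series and integrals -/

/-- The sum of a series of holomorphic functions that is dominated on an open set is holomorphic
there. -/
lemma differentiableOn_tsum_of_norm_le {ι E : Type*} [NormedAddCommGroup E] [NormedSpace ℂ E]
    {f : ι → E → ℂ} {V : Set E} {u : ι → ℝ} (hV : IsOpen V) (hu : Summable u)
    (hf : ∀ i, DifferentiableOn ℂ (f i) V) (hb : ∀ i, ∀ z ∈ V, ‖f i z‖ ≤ u i) :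
    DifferentiableOn ℂ (fun z => ∑' i, f i z) V := by
  intro z hz
  obtain ⟨r, hr, hball⟩ := Metric.isOpen_iff.1 hV z hz
  have hsub : ∀ y ∈ ball z (r / 2), ball y (r / 2) ⊆ V := fun y hy p hp => hball <| by
    have h1 := dist_triangle p y z
    simp only [mem_ball] at hy hp ⊢
    linarith
  let : NormedSpace ℝ E := NormedSpace.restrictScalars ℝ ℂ E
  have hd : ∀ i, ∀ y ∈ ball z (r / 2), HasFDerivAt (f i) (fderiv ℂ (f i) y) y := fun i y hy =>
    ((hf i).differentiableAt
      (hV.mem_nhds (hsub y hy (mem_ball_self (by positivity))))).hasFDerivAt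
  have hfb : ∀ i, ∀ y ∈ ball z (r / 2), ‖fderiv ℂ (f i) y‖ ≤ 2 * u i / (r / 2) := by
    intro i y hy
    -- Cauchy's estimate: on a ball of radius `r / 2` the values stay within `2 * u i` of the value
    -- at the centre, so no bound on derivatives has to be assumed.
    refine Complex.norm_fderiv_le_div_of_mapsTo_ball ((hf i).mono (hsub y hy)) ?_ (by positivity)
    intro p hp
    rw [mem_closedBall, dist_eq_norm]
    have h1 := hb i p (hsub y hy hp)
    have h2 := hb i y (hsub y hy (mem_ball_self (by positivity)))
    linarith [norm_sub_le (f i p) (f i y)]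
  refine (hasFDerivAt_tsum_of_isPreconnected ((hu.mul_left 2).div_const (r / 2)) isOpen_ball
    (convex_ball z (r / 2)).isPreconnected hd hfb (mem_ball_self (by positivity))
    (.of_norm_bounded hu fun i => hb i z hz)
    (mem_ball_self (by positivity))).differentiableAt.differentiableWithinAt

/-- The integral of a dominated family of holomorphic functions is holomorphic. -/
lemma differentiableAt_integral_of_norm_le {α E : Type*} [MeasurableSpace α] {μ : Measure α}
    [NormedAddCommGroup E] [NormedSpace ℂ E] {F : E → α → ℂ} {F' : E → α → E →L[ℂ] ℂ}
    {V : Set E} {z : E} {bound : α → ℝ} (hV : IsOpen V) (hz : z ∈ V)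
    (hF : ∀ y, AEStronglyMeasurable (F y) μ) (hF' : AEStronglyMeasurable (F' z) μ)
    (hb : ∀ᵐ a ∂μ, ∀ y ∈ V, ‖F y a‖ ≤ bound a) (hbound : Integrable bound μ)
    (hd : ∀ᵐ a ∂μ, ∀ y ∈ V, HasFDerivAt (F · a) (F' y a) y) :
    DifferentiableAt ℂ (fun y => ∫ a, F y a ∂μ) z := by
  obtain ⟨r, hr, hball⟩ := Metric.isOpen_iff.1 hV z hz
  have hsub : ∀ y ∈ ball z (r / 2), ball y (r / 2) ⊆ V := fun y hy p hp => hball <| by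
    have h1 := dist_triangle p y z
    simp only [mem_ball] at hy hp ⊢
    linarith
  refine (hasFDerivAt_integral_of_dominated_of_fderiv_le (F' := F')
    (bound := fun a => 2 * bound a / (r / 2)) (ball_mem_nhds z (half_pos hr))
    (.of_forall hF) (hbound.mono' (hF z) (hb.mono fun a ha => ha z hz)) hF' ?_
    ((hbound.const_mul 2).div_const _) ?_).differentiableAt
  · filter_upwards [hb, hd] with a ha hda y hy
    rw [← (hda y (hsub y hy (mem_ball_self (by positivity)))).fderiv]
    refine Complex.norm_fderiv_le_div_of_mapsTo_ball
      (fun p hp => (hda p (hsub y hy hp)).differentiableAt.differentiableWithinAt) ?_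
      (by positivity)
    intro p hp
    rw [mem_closedBall, dist_eq_norm]
    have h1 := ha p (hsub y hy hp)
    have h2 := ha y (hsub y hy (mem_ball_self (by positivity)))
    linarith [norm_sub_le (F p a) (F y a)]
  · filter_upwards [hd] with a hda y hy
    exact hda y (hsub y hy (mem_ball_self (by positivity)))

/-! ### The domain and uniqueness of the continuation -/

lemma isOpen_avDomain : IsOpen avDomain := by
  have h1 : IsOpen {s : ℂ × ℂ × ℂ | 0 < s.1.re + s.2.2.re} :=
    isOpen_lt (by fun_prop) (by fun_prop)
  have h2 : IsOpen {s : ℂ × ℂ × ℂ | 2 < s.1.re + s.2.1.re + s.2.2.re} :=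
    isOpen_lt (by fun_prop) (by fun_prop)
  have h3 : IsOpen {s : ℂ × ℂ × ℂ | s.1 + s.2.2 ≠ 1} := isOpen_ne_fun (by fun_prop) (by fun_prop)
  exact h1.inter (h2.inter h3)

/-- Serves to join q = s₁+s₃-1 to a point p of the convergence region without meeting 0: both lie in
one open half-plane Re(c·) > 0. The freedom in Im p makes this possible even when q is negative. -/
lemma exists_halfPlane {q : ℂ} (hq : q ≠ 0) :
    ∃ c p : ℂ, 0 < (c * q).re ∧ 0 < (c * p).re ∧ 3 < p.re := by
  rcases lt_trichotomy q.im 0 with h | h | h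
  · exact ⟨Complex.I, 4 - Complex.I, by simpa using h, by simp, by norm_num⟩
  · have : q.re ≠ 0 := fun h' => hq (Complex.ext h' h)
    rcases this.lt_or_gt with h' | h'
    · exact ⟨-1 - 10 * Complex.I, 4 + Complex.I, by simpa [h] using h', by norm_num, by norm_num⟩
    · exact ⟨1, 4, by simpa using h', by norm_num, by norm_num⟩
  · exact ⟨-Complex.I, 4 + Complex.I, by simpa using h, by simp, by norm_num⟩

lemma convex_lt_re_add_mul (r : ℝ) (a b : ℂ) : Convex ℝ {w : ℂ | r < (a + w * b).re} := by
  intro x hx y hy s t hs ht hst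
  simp only [mem_ofPred_eq] at hx hy ⊢
  have : (a + (s • x + t • y) * b).re = s * (a + x * b).re + t * (a + y * b).re := by
    have e : t = 1 - s := by linarith
    subst e
    simp
    ring
  rw [this]
  have e : r = s * r + t * r := by rw [← add_mul, hst, one_mul]
  rw [e]
  rcases hs.eq_or_lt with rfl | hs'
  · have : t = 1 := by linarith
    subst this; linarith
  · linarith [mul_lt_mul_of_pos_left hx hs', mul_le_mul_of_nonneg_left hy.le ht]

/-- The analytic continuation of the Apostol-Vu double series is unique. -/
lemma IsAVContinuation.eqOn {F G : ℂ × ℂ × ℂ → ℂ} (hF : IsAVContinuation F)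
    (hG : IsAVContinuation G) : EqOn F G avDomain := by
  rintro ⟨s₁, s₂, s₃⟩ hs
  obtain ⟨h1, h2, h3⟩ := id hs
  simp only at h1 h2 h3
  obtain ⟨c, p, hcq, hcp, hp⟩ := exists_halfPlane (q := s₁ + s₃ - 1) (sub_ne_zero.2 h3)
  -- At `e` the value of s₁+s₃-1 is `p`, and 3 < Re p puts `e` in the region of convergence.
  set e : ℂ × ℂ × ℂ := (p / 2 + 1 / 2, 2, p / 2 + 1 / 2) with he
  let z : ℂ → ℂ × ℂ × ℂ := fun w => (s₁, s₂, s₃) + w • (e - (s₁, s₂, s₃))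
  -- On the complex line through the given point (w = 0) and `e` (w = 1), each condition is a
  -- half-plane in `w`. The third replaces s₁+s₃ ≠ 1 by a convex condition, so `U` is connected and
  -- the one-variable identity theorem applies.
  let U : Set ℂ := {w | 0 < ((s₁ + s₃) + w * (p + 1 - (s₁ + s₃))).re} ∩
    ({w | 2 < ((s₁ + s₂ + s₃) + w * (p + 3 - (s₁ + s₂ + s₃))).re} ∩
      {w | 0 < (c * (s₁ + s₃ - 1) + w * (c * p - c * (s₁ + s₃ - 1))).re})
  have hUo : IsOpen U :=
    (isOpen_lt (by fun_prop) (by fun_prop)).inter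
      ((isOpen_lt (by fun_prop) (by fun_prop)).inter (isOpen_lt (by fun_prop) (by fun_prop)))
  have hUc : IsPreconnected U :=
    ((convex_lt_re_add_mul _ _ _).inter ((convex_lt_re_add_mul _ _ _).inter
      (convex_lt_re_add_mul _ _ _))).isPreconnected
  have hzU : MapsTo z U avDomain := by
    rintro w ⟨hw1, hw2, hw3⟩
    simp only [mem_ofPred_eq] at hw1 hw2 hw3
    refine ⟨?_, ?_, ?_⟩
    · rw [← Complex.add_re]
      convert hw1 using 2
      simp [z, he]; ring
    · rw [← Complex.add_re, ← Complex.add_re]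
      convert hw2 using 2
      simp [z, he]; ring
    · intro h
      have : c * (s₁ + s₃ - 1) + w * (c * p - c * (s₁ + s₃ - 1)) =
          c * ((z w).1 + (z w).2.2 - 1) := by simp [z, he]; ring
      rw [this, h] at hw3
      simp at hw3
  have hzd : Differentiable ℂ z := by fun_prop
  have hA : ∀ {H}, IsAVContinuation H → AnalyticOnNhd ℂ (fun w => H (z w)) U := fun hH =>
    (hH.1.comp hzd.differentiableOn hzU).analyticOnNhd hUo
  have h1U : (1 : ℂ) ∈ U := by
    refine ⟨?_, ?_, ?_⟩
    · simp; linarith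
    · simp; linarith
    · simpa using hcp
  have h0U : (0 : ℂ) ∈ U := by
    refine ⟨by simpa using h1, by simpa using h2, by simpa using hcq⟩
  have hev : (fun w => F (z w)) =ᶠ[𝓝 1] fun w => G (z w) := by
    have hz1 : z 1 = e := by simp [z]
    have hre : 1 < e.1.re := by simp [he]; linarith
    have o1 : ∀ᶠ w in 𝓝 (1 : ℂ), 1 < (z w).1.re :=
      (by fun_prop : Continuous fun w => (z w).1.re).continuousAt.eventually_const_lt
        (by simpa only [hz1] using hre)
    have o2 : ∀ᶠ w in 𝓝 (1 : ℂ), 1 < (z w).2.1.re :=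
      (by fun_prop : Continuous fun w => (z w).2.1.re).continuousAt.eventually_const_lt
        (by simp only [hz1]; norm_num [he])
    have o3 : ∀ᶠ w in 𝓝 (1 : ℂ), 1 < (z w).2.2.re :=
      (by fun_prop : Continuous fun w => (z w).2.2.re).continuousAt.eventually_const_lt
        (by simpa only [hz1] using hre)
    filter_upwards [o1, o2, o3] with w w1 w2 w3
    exact (hF.2 _ _ _ w1 w2 w3).unique (hG.2 _ _ _ w1 w2 w3)
  simpa [z] using (hA hF).eqOn_of_preconnected_of_eventuallyEq (hA hG) hUc h1U hev h0U

/-! ### The kernel and its tail integrals -/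

/-- The function `u ↦ u^{-a} (u+ν)^{-b}`. -/
noncomputable def kern (a b : ℂ) (ν u : ℝ) : ℂ := (u : ℂ) ^ (-a) * ((u : ℂ) + (ν : ℂ)) ^ (-b)

lemma kern_eq_exp (a b : ℂ) {ν u : ℝ} (hu : 0 < u) (hν : 0 ≤ ν) :
    kern a b ν u = Complex.exp (-a * Real.log u - b * Real.log (u + ν)) := by
  have h1 : (u : ℂ) ≠ 0 := by exact_mod_cast hu.ne'
  have h2 : (u : ℂ) + ν ≠ 0 := by exact_mod_cast (by positivity : u + ν ≠ 0)
  rw [kern, Complex.cpow_def_of_ne_zero h1, Complex.cpow_def_of_ne_zero h2, ← Complex.exp_add,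
    Complex.ofReal_log hu.le, Complex.ofReal_log (by positivity)]
  push_cast
  ring_nf

lemma norm_kern (a b : ℂ) {ν u : ℝ} (hu : 0 < u) (hν : 0 ≤ ν) :
    ‖kern a b ν u‖ = u ^ (-a.re) * (u + ν) ^ (-b.re) := by
  rw [kern, norm_mul, ← Complex.ofReal_add, Complex.norm_cpow_eq_rpow_re_of_pos hu,
    Complex.norm_cpow_eq_rpow_re_of_pos (by positivity), Complex.neg_re, Complex.neg_re]

lemma norm_kern_le (a b : ℂ) {ν u c : ℝ} (hu : 0 < u) (hν : 0 ≤ ν) (h : u + ν ≤ c * u) :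
    ‖kern a b ν u‖ ≤ c ^ |b.re| * u ^ (-(a + b).re) := by
  have hc : 1 ≤ c := by
    by_contra hc
    nlinarith
  have hc0 : 0 < c := by positivity
  have h1 : (u + ν) ^ (-b.re) ≤ c ^ |b.re| * u ^ (-b.re) := by
    rcases le_total 0 b.re with hb | hb
    · rw [abs_of_nonneg hb]
      have h2 : (u + ν) ^ (-b.re) ≤ u ^ (-b.re) :=
        Real.rpow_le_rpow_of_nonpos hu (by linarith) (by linarith)
      have h3 : 1 ≤ c ^ b.re := Real.one_le_rpow hc hb
      nlinarith [Real.rpow_nonneg hu.le (-b.re)]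
    · rw [abs_of_nonpos hb, ← Real.mul_rpow hc0.le hu.le]
      exact Real.rpow_le_rpow (by positivity) h (by linarith)
  rw [norm_kern a b hu hν, Complex.add_re, neg_add, Real.rpow_add hu]
  calc _ ≤ u ^ (-a.re) * (c ^ |b.re| * u ^ (-b.re)) := by gcongr
    _ = _ := by ring

lemma kern_add_one_left (a b : ℂ) {ν u : ℝ} (hu : 0 < u) :
    kern (a + 1) b ν u = kern a b ν u / u := by
  have h1 : (u : ℂ) ≠ 0 := by exact_mod_cast hu.ne'
  rw [kern, kern, neg_add, Complex.cpow_add _ _ h1, Complex.cpow_neg_one]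
  ring

lemma kern_add_one_right (a b : ℂ) {ν u : ℝ} (hu : 0 < u) (hν : 0 ≤ ν) :
    kern a (b + 1) ν u = kern a b ν u / (u + ν) := by
  have h2 : (u : ℂ) + ν ≠ 0 := by exact_mod_cast (by positivity : u + ν ≠ 0)
  rw [kern, kern, neg_add, Complex.cpow_add _ _ h2, Complex.cpow_neg_one]
  ring

lemma hasDerivAt_kern (a b : ℂ) {ν u : ℝ} (hu : 0 < u) (hν : 0 ≤ ν) :
    HasDerivAt (kern a b ν) (-a * kern (a + 1) b ν u - b * kern a (b + 1) ν u) u := by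
  have h1 : HasDerivAt (fun u : ℝ => Complex.exp (-a * Real.log u - b * Real.log (u + ν)))
      (Complex.exp (-a * Real.log u - b * Real.log (u + ν)) *
        (-a * (u⁻¹ : ℝ) - b * ((u + ν)⁻¹ : ℝ))) u := by
    refine HasDerivAt.cexp (.sub (.const_mul _ ?_) (.const_mul _ ?_))
    · exact (Real.hasDerivAt_log hu.ne').ofReal_comp
    · have := ((hasDerivAt_id u).add_const ν).log (by simp; positivity)
      simpa using this.ofReal_comp
  rw [kern_add_one_left a b hu, kern_add_one_right a b hu hν, kern_eq_exp a b hu hν]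
  refine (h1.congr_of_eventuallyEq ?_).congr_deriv ?_
  rotate_left
  · push_cast; ring
  · filter_upwards [lt_mem_nhds hu] with v hv
    exact kern_eq_exp a b hv hν

lemma continuousOn_kern (a b : ℂ) {ν : ℝ} (hν : 0 ≤ ν) : ContinuousOn (kern a b ν) (Ioi 0) :=
  fun _ hu => (hasDerivAt_kern a b hu hν).continuousAt.continuousWithinAt

lemma measurable_kern (a b : ℂ) (ν : ℝ) : Measurable (kern a b ν) := by
  unfold kern
  fun_prop

lemma norm_weight_mul_kern_le (a b : ℂ) {w : ℝ → ℝ} {ν u c : ℝ} (hw : |w u| ≤ 1) (hc : 0 < c)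
    (hν : 0 ≤ ν) (hu : c < u) :
    ‖(w u : ℂ) * kern a b ν u‖ ≤ (1 + ν / c) ^ |b.re| * u ^ (-(a + b).re) := by
  have hu0 : 0 < u := hc.trans hu
  rw [norm_mul, Complex.norm_real, Real.norm_eq_abs]
  have h1 := norm_kern_le a b (c := 1 + ν / c) hu0 hν (by
    have : ν ≤ ν / c * u := by rw [div_mul_eq_mul_div, le_div_iff₀ hc]; gcongr
    linarith)
  nlinarith [norm_nonneg (kern a b ν u), abs_nonneg (w u)]

lemma integrableOn_weight_mul_kern {a b : ℂ} (hab : 1 < (a + b).re) {w : ℝ → ℝ}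
    (hwm : Measurable w) (hw : ∀ u, |w u| ≤ 1) {ν c : ℝ} (hν : 0 ≤ ν) (hc : 0 < c) :
    IntegrableOn (fun u => (w u : ℂ) * kern a b ν u) (Ioi c) := by
  refine Integrable.mono'
    ((integrableOn_Ioi_rpow_of_lt (by linarith : -(a + b).re < -1) hc).const_mul
      ((1 + ν / c) ^ |b.re|)) ?_ ?_
  · exact ((Complex.measurable_ofReal.comp hwm).mul (measurable_kern a b ν)).aestronglyMeasurable
  · filter_upwards [ae_restrict_mem measurableSet_Ioi] with u hu
    exact norm_weight_mul_kern_le a b (hw u) hc hν hu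

lemma integrableOn_kern {a b : ℂ} (hab : 1 < (a + b).re) {ν c : ℝ} (hν : 0 ≤ ν) (hc : 0 < c) :
    IntegrableOn (kern a b ν) (Ioi c) := by
  simpa using integrableOn_weight_mul_kern hab (w := fun _ => 1) measurable_const (by simp) hν hc

/-- The weighted tail integral of `kern`. -/
noncomputable def kernTail (w : ℝ → ℝ) (a b : ℂ) (ν c : ℝ) : ℂ := ∫ u in Ioi c, (w u : ℂ) * kern a b ν u

lemma norm_kernTail_le {a b : ℂ} (hab : 1 < (a + b).re) {w : ℝ → ℝ}
    (hw : ∀ u, |w u| ≤ 1) {ν c : ℝ} (hν : 0 ≤ ν) (hc : 0 < c) :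
    ‖kernTail w a b ν c‖ ≤
      (1 + ν / c) ^ |b.re| * (c ^ (1 - (a + b).re) / ((a + b).re - 1)) := by
  refine (norm_integral_le_of_norm_le
    ((integrableOn_Ioi_rpow_of_lt (by linarith : -(a + b).re < -1) hc).const_mul
      ((1 + ν / c) ^ |b.re|)) ?_).trans_eq ?_
  · filter_upwards [ae_restrict_mem measurableSet_Ioi] with u hu
    exact norm_weight_mul_kern_le a b (hw u) hc hν hu
  · rw [integral_const_mul, integral_Ioi_rpow_of_lt (by linarith : -(a + b).re < -1) hc]
    congr 1
    rw [← neg_div_neg_eq]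
    ring_nf

lemma differentiableAt_kernTail {p : ℂ × ℂ} (hp : 1 < (p.1 + p.2).re) {w : ℝ → ℝ}
    (hwm : Measurable w) (hw : ∀ u, |w u| ≤ 1) {ν c : ℝ} (hν : 0 ≤ ν) (hc : 1 ≤ c) :
    DifferentiableAt ℂ (fun q : ℂ × ℂ => kernTail w q.1 q.2 ν c) p := by
  obtain ⟨δ, hδ1, hδ⟩ := exists_between hp
  have hc0 : 0 < c := by linarith
  -- A neighbourhood with one integrable majorant: 1 < `δ` stays below the real part of the
  -- exponent, and `1 ≤ c` makes u^(-·) monotone on the range of integration.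
  let V : Set (ℂ × ℂ) := {q | δ < (q.1 + q.2).re} ∩ {q | |q.2.re| < |p.2.re| + 1}
  have hV : IsOpen V :=
    (isOpen_lt (by fun_prop) (by fun_prop)).inter (isOpen_lt (by fun_prop) (by fun_prop))
  let F' : ℂ × ℂ → ℝ → ℂ × ℂ →L[ℂ] ℂ := fun q u => ((w u : ℂ) * kern q.1 q.2 ν u) •
    (-((Real.log u : ℂ) • ContinuousLinearMap.fst ℂ ℂ ℂ) -
      (Real.log (u + ν) : ℂ) • ContinuousLinearMap.snd ℂ ℂ ℂ)
  refine differentiableAt_integral_of_norm_le (V := V) (F' := F')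
    (bound := fun u => (1 + ν / c) ^ (|p.2.re| + 1) * u ^ (-δ)) hV ⟨hδ, by simp⟩ ?_ ?_ ?_ ?_ ?_
  · intro y
    exact ((Complex.measurable_ofReal.comp hwm).mul
      (measurable_kern _ _ ν)).aestronglyMeasurable
  · refine AEStronglyMeasurable.smul ((Complex.measurable_ofReal.comp hwm).mul
      (measurable_kern _ _ ν)).aestronglyMeasurable (.sub (.neg (.smul_const ?_ _))
        (.smul_const ?_ _))
    · exact (by fun_prop : Measurable fun u : ℝ => (Real.log u : ℂ)).aestronglyMeasurable
    · exact (by fun_prop : Measurable fun u : ℝ => (Real.log (u + ν) : ℂ)).aestronglyMeasurable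
  · filter_upwards [ae_restrict_mem measurableSet_Ioi] with u hu y hy
    refine (norm_weight_mul_kern_le _ _ (hw u) hc0 hν hu).trans ?_
    have hu1 : 1 ≤ u := hc.trans (mem_Ioi.1 hu).le
    have h1 : 1 ≤ 1 + ν / c := by have : 0 ≤ ν / c := by positivity
                                  linarith
    gcongr
    · exact hy.2.le
    · exact hy.1.le
  · exact (integrableOn_Ioi_rpow_of_lt (by linarith) hc0).const_mul _
  · filter_upwards [ae_restrict_mem measurableSet_Ioi] with u hu y hy
    have hu0 : 0 < u := hc0.trans hu
    have h0 : HasFDerivAt (fun q : ℂ × ℂ => -q.1 * (Real.log u : ℂ) - q.2 * Real.log (u + ν))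
        (-((Real.log u : ℂ) • ContinuousLinearMap.fst ℂ ℂ ℂ) -
      (Real.log (u + ν) : ℂ) • ContinuousLinearMap.snd ℂ ℂ ℂ) y := by
      refine ((((ContinuousLinearMap.fst ℂ ℂ ℂ).hasFDerivAt (x := y)).neg.mul_const
        (Real.log u : ℂ)).sub (((ContinuousLinearMap.snd ℂ ℂ ℂ).hasFDerivAt (x := y)).mul_const
        (Real.log (u + ν) : ℂ))).congr_fderiv ?_
      ext <;> simp
    have h2 := (h0.cexp.const_mul (w u : ℂ))
    simp only [kern_eq_exp _ _ hu0 hν, F']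
    refine h2.congr_fderiv ?_
    rw [smul_smul]

lemma abs_fract_le_one (u : ℝ) : |Int.fract u| ≤ 1 := by
  rw [abs_of_nonneg (Int.fract_nonneg u)]
  exact (Int.fract_lt_one u).le

lemma kernTail_sub {a b : ℂ} (hab : 1 < (a + b).re) {w : ℝ → ℝ} (hwm : Measurable w)
    (hw : ∀ u, |w u| ≤ 1) {ν c d : ℝ} (hν : 0 ≤ ν) (hc : 0 < c) (hcd : c ≤ d) :
    kernTail w a b ν c - kernTail w a b ν d = ∫ u in c..d, (w u : ℂ) * kern a b ν u :=
  intervalIntegral.integral_Ioi_sub_Ioi (integrableOn_weight_mul_kern hab hwm hw hν hc) hcd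

lemma intervalIntegrable_weight_mul_kern {a b : ℂ} (hab : 1 < (a + b).re) {w : ℝ → ℝ}
    (hwm : Measurable w) (hw : ∀ u, |w u| ≤ 1) {ν c d : ℝ} (hν : 0 ≤ ν) (hc : 0 < c)
    (hcd : c ≤ d) : IntervalIntegrable (fun u => (w u : ℂ) * kern a b ν u) volume c d :=
  (intervalIntegrable_iff_integrableOn_Ioc_of_le hcd).2
    ((integrableOn_weight_mul_kern hab hwm hw hν hc).mono_set Ioc_subset_Ioi_self)

lemma continuousOn_kern_uIcc (a b : ℂ) {ν c d : ℝ} (hν : 0 ≤ ν) (hc : 0 < c) (hcd : c ≤ d) :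
    ContinuousOn (kern a b ν) (uIcc c d) :=
  (continuousOn_kern a b hν).mono fun u hu => by
    rw [uIcc_of_le hcd] at hu
    exact hc.trans_le hu.1

/-! ### Euler summation for the kernel -/

/-- The analytic continuation in `(a, b)` of the integral of `kern a b ν` over `(c, ∞)`. -/
noncomputable def kernMain (a b : ℂ) (ν c : ℝ) : ℂ :=
  kern (a - 1) b ν c / (a + b - 1) +
    b * ν / (a + b - 1) * kernTail (fun _ => 1) a (b + 1) ν c

/-- The remainder of Euler's summation formula for `kern a b ν` on `(c, ∞)`. -/
noncomputable def kernRem (a b : ℂ) (ν c : ℝ) : ℂ :=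
  ((Int.fract c : ℝ) : ℂ) * kern a b ν c +
    (-a * kernTail Int.fract (a + 1) b ν c - b * kernTail Int.fract a (b + 1) ν c)

/-- Since u/(u+ν) = 1 - ν/(u+ν), the derivative of u^(1-a)(u+ν)^(-b) is (1-a-b) times the kernel
plus bν times the kernel with `b + 1`. The latter has a convergent tail integral already for Re(a+b)
> 0. -/
lemma integral_kern {a b : ℂ} (hab : 0 < (a + b).re) (hab1 : a + b ≠ 1) {ν c d : ℝ}
    (hν : 0 ≤ ν) (hc : 0 < c) (hcd : c ≤ d) :
    ∫ u in c..d, kern a b ν u = kernMain a b ν c - kernMain a b ν d := by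
  have h0 : a + b - 1 ≠ 0 := sub_ne_zero.2 hab1
  have hab' : 1 < (a + (b + 1)).re := by
    simp only [Complex.add_re, Complex.one_re] at hab ⊢; linarith
  have ht := kernTail_sub hab' (w := fun _ => 1) measurable_const (by simp) hν hc hcd
  have hi : ∀ a b : ℂ, IntervalIntegrable (kern a b ν) volume c d := fun a b =>
    (continuousOn_kern_uIcc a b hν hc hcd).intervalIntegrable
  have hF := intervalIntegral.integral_eq_sub_of_hasDerivAt (a := c) (b := d)
    (f := kern (a - 1) b ν)
    (f' := fun u => -(a - 1) * kern (a - 1 + 1) b ν u - b * kern (a - 1) (b + 1) ν u)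
    (fun u hu => by
      rw [uIcc_of_le hcd] at hu
      exact hasDerivAt_kern (a - 1) b (hc.trans_le hu.1) hν)
    (((hi _ _).const_mul _).sub ((hi _ _).const_mul _))
  have hE : ∫ u in c..d, (a + b - 1) * kern a b ν u =
      -(kern (a - 1) b ν d - kern (a - 1) b ν c) +
        b * ν * (kernTail (fun _ => 1) a (b + 1) ν c - kernTail (fun _ => 1) a (b + 1) ν d) := by
    rw [ht, ← hF, ← intervalIntegral.integral_neg, ← intervalIntegral.integral_const_mul,
      ← intervalIntegral.integral_add]
    · refine intervalIntegral.integral_congr fun u hu => ?_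
      rw [uIcc_of_le hcd] at hu
      have hu0 : 0 < u := hc.trans_le hu.1
      have h2 : (u : ℂ) + ν ≠ 0 := by exact_mod_cast (by positivity : u + ν ≠ 0)
      have h1 : (u : ℂ) ≠ 0 := by exact_mod_cast hu0.ne'
      have h3 := kern_add_one_left (a - 1) b (ν := ν) hu0
      rw [sub_add_cancel] at h3
      have h4 : kern (a - 1) b ν u = u * kern a b ν u := by rw [h3]; field_simp
      simp only [sub_add_cancel, kern_add_one_right _ _ hu0 hν, h4, Complex.ofReal_one, one_mul]
      field_simp
      ring
    · exact (((hi _ _).const_mul _).sub ((hi _ _).const_mul _)).neg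
    · simpa using (hi a (b + 1)).const_mul _
  rw [intervalIntegral.integral_const_mul] at hE
  rw [← mul_right_inj' h0, hE, kernMain, kernMain]
  field_simp
  ring

lemma sum_kern_eq_integral {a b : ℂ} (hab : 0 < (a + b).re) {ν c d : ℝ}
    (hν : 0 ≤ ν) (hc : 0 < c) (hcd : c ≤ d) :
    ∑ k ∈ Finset.Ioc ⌊c⌋₊ ⌊d⌋₊, kern a b ν k =
      (∫ u in c..d, kern a b ν u) + kernRem a b ν c - kernRem a b ν d := by
  have h1 : 1 < (a + 1 + b).re := by
    simp only [Complex.add_re, Complex.one_re] at hab ⊢; linarith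
  have h2 : 1 < (a + (b + 1)).re := by
    simp only [Complex.add_re, Complex.one_re] at hab ⊢; linarith
  have ht1 := kernTail_sub h1 measurable_fract abs_fract_le_one hν hc hcd
  have ht2 := kernTail_sub h2 measurable_fract abs_fract_le_one hν hc hcd
  have hw1 := intervalIntegrable_weight_mul_kern h1 measurable_fract abs_fract_le_one hν hc hcd
  have hw2 := intervalIntegrable_weight_mul_kern h2 measurable_fract abs_fract_le_one hν hc hcd
  have hi : ∀ a b : ℂ, IntervalIntegrable (kern a b ν) volume c d := fun a b =>
    (continuousOn_kern_uIcc a b hν hc hcd).intervalIntegrable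
  set k' : ℝ → ℂ := fun u => -a * kern (a + 1) b ν u - b * kern a (b + 1) ν u with hk'
  have hk'i : IntervalIntegrable k' volume c d := ((hi _ _).const_mul _).sub ((hi _ _).const_mul _)
  have hk'c : ContinuousOn k' (uIcc c d) :=
    (continuousOn_const.mul (continuousOn_kern_uIcc _ _ hν hc hcd)).sub
      (continuousOn_const.mul (continuousOn_kern_uIcc _ _ hν hc hcd))
  have hder : ∀ u ∈ Icc c d, HasDerivAt (kern a b ν) (k' u) u := fun u hu =>
    hasDerivAt_kern a b (hc.trans_le hu.1) hν
  have habel := sum_mul_eq_sub_sub_integral_mul (fun _ => (1 : ℂ)) hc.le hcd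
    (f := kern a b ν) (fun u hu => (hder u hu).differentiableAt)
    (((intervalIntegrable_iff_integrableOn_Icc_of_le hcd).1 hk'i).congr_fun
      (fun u hu => (hder u hu).deriv.symm) measurableSet_Icc)
  -- The `+ 1` counts the index k = 0. It is carried through the integration by parts of (u+1)f(u)
  -- and cancels.
  have hfl : ∀ u : ℝ, 0 ≤ u → (∑ k ∈ Finset.Icc 0 ⌊u⌋₊, (1 : ℂ)) = u - (Int.fract u : ℝ) + 1 := by
    intro u hu
    rw [Finset.sum_const, Nat.card_Icc, nsmul_eq_mul, mul_one, tsub_zero, Nat.cast_add,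
      ← Complex.ofReal_sub, Int.self_sub_fract, ← natCast_floor_eq_intCast_floor hu]
    push_cast
    ring
  have hparts : ∫ u in c..d, (kern a b ν u + ((u : ℂ) + 1) * k' u) =
      (d + 1) * kern a b ν d - (c + 1) * kern a b ν c := by
    refine intervalIntegral.integral_eq_sub_of_hasDerivAt
      (f := fun u : ℝ => ((u : ℂ) + 1) * kern a b ν u) (fun u hu => ?_) ?_
    · rw [uIcc_of_le hcd] at hu
      have := ((hasDerivAt_id u).ofReal_comp.add_const (1 : ℂ)).mul (hder u hu)
      refine this.congr_deriv ?_
      simp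
    · exact (hi a b).add (hk'c.intervalIntegrable.continuousOn_mul (by fun_prop))
  have hU : ∀ u : ℝ, ((Int.fract u : ℝ) : ℂ) * k' u =
      -a * ((Int.fract u : ℝ) * kern (a + 1) b ν u) - b * ((Int.fract u : ℝ) * kern a (b + 1) ν u) :=
    fun u => by rw [hk']; ring
  have hfk : IntervalIntegrable (fun u => ((Int.fract u : ℝ) : ℂ) * k' u) volume c d := by
    simp only [hU]
    exact (hw1.const_mul _).sub (hw2.const_mul _)
  have hI : ∫ u in Ioc c d, deriv (kern a b ν) u * ∑ k ∈ Finset.Icc 0 ⌊u⌋₊, (1 : ℂ) =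
      (∫ u in c..d, ((u : ℂ) + 1) * k' u) - ∫ u in c..d, ((Int.fract u : ℝ) : ℂ) * k' u := by
    rw [← intervalIntegral.integral_of_le hcd, ← intervalIntegral.integral_sub
      (hk'c.intervalIntegrable.continuousOn_mul (by fun_prop)) hfk]
    refine intervalIntegral.integral_congr fun u hu => ?_
    rw [uIcc_of_le hcd] at hu
    simp only [(hder u hu).deriv, hfl u (hc.le.trans hu.1)]
    ring
  rw [intervalIntegral.integral_add (hi a b) (hk'i.continuousOn_mul (by fun_prop))] at hparts
  have hJ : ∫ u in c..d, ((Int.fract u : ℝ) : ℂ) * k' u =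
      -a * (kernTail Int.fract (a + 1) b ν c - kernTail Int.fract (a + 1) b ν d) -
        b * (kernTail Int.fract a (b + 1) ν c - kernTail Int.fract a (b + 1) ν d) := by
    simp only [hU]
    rw [intervalIntegral.integral_sub (hw1.const_mul _) (hw2.const_mul _),
      intervalIntegral.integral_const_mul, intervalIntegral.integral_const_mul, ht1, ht2]
  rw [hI, hJ, hfl c hc.le, hfl d (hc.le.trans hcd)] at habel
  simp only [mul_one] at habel
  rw [habel, kernRem, kernRem]
  linear_combination -hparts

/-- The regularized value of `∑_{m > c} kern a b ν m`. -/
noncomputable def kernSum (a b : ℂ) (ν c : ℝ) : ℂ := kernMain a b ν c + kernRem a b ν c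

lemma sum_kern {a b : ℂ} (hab : 0 < (a + b).re) (hab1 : a + b ≠ 1) {ν c d : ℝ}
    (hν : 0 ≤ ν) (hc : 0 < c) (hcd : c ≤ d) :
    ∑ k ∈ Finset.Ioc ⌊c⌋₊ ⌊d⌋₊, kern a b ν k = kernSum a b ν c - kernSum a b ν d := by
  rw [sum_kern_eq_integral hab hν hc hcd, integral_kern hab hab1 hν hc hcd, kernSum, kernSum]
  ring

/-! ### Bounds that are locally uniform in the exponents -/

lemma norm_kernTail_le_of_le {a b : ℂ} {δ M : ℝ} (hδ : 0 < δ) (hab : 1 + δ ≤ (a + b).re)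
    (hb : |b.re| ≤ M) {w : ℝ → ℝ} (hw : ∀ u, |w u| ≤ 1) {ν c : ℝ} (hν : 0 ≤ ν) (hc : 0 < c)
    (hνc : ν ≤ c) : ‖kernTail w a b ν c‖ ≤ 2 ^ M / δ * c ^ (1 - (a + b).re) := by
  have h1 : ν / c ≤ 1 := (div_le_one hc).2 hνc
  have h2 : (1 + ν / c) ^ |b.re| ≤ 2 ^ M := by
    calc (1 + ν / c) ^ |b.re| ≤ 2 ^ |b.re| := by
          gcongr; linarith
      _ ≤ 2 ^ M := by gcongr; norm_num
  calc _ ≤ (1 + ν / c) ^ |b.re| * (c ^ (1 - (a + b).re) / ((a + b).re - 1)) :=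
        norm_kernTail_le (by linarith) hw hν hc
    _ ≤ 2 ^ M * (c ^ (1 - (a + b).re) / δ) := by
        refine mul_le_mul h2 ?_ (div_nonneg (by positivity) (by linarith)) (by positivity)
        gcongr
        linarith
    _ = _ := by ring

lemma norm_kern_le_of_le {a b : ℂ} {M : ℝ} (hb : |b.re| ≤ M) {ν c : ℝ} (hν : 0 ≤ ν) (hc : 0 < c)
    (hνc : ν ≤ c) : ‖kern a b ν c‖ ≤ 2 ^ M * c ^ (-(a + b).re) :=
  (norm_kern_le a b (c := 2) hc hν (by linarith)).trans (by gcongr; norm_num)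

lemma norm_kernRem_le {a b : ℂ} {δ M : ℝ} (hδ : 0 < δ) (hab : δ ≤ (a + b).re)
    (ha : ‖a‖ ≤ M) (hb : ‖b‖ ≤ M) {ν c : ℝ} (hν : 0 ≤ ν) (hc : 0 < c) (hνc : ν ≤ c) :
    ‖kernRem a b ν c‖ ≤ 2 ^ (M + 1) * (1 + 2 * M / δ) * c ^ (-(a + b).re) := by
  have hM : 0 ≤ M := (norm_nonneg a).trans ha
  have hb' : |b.re| ≤ M + 1 := (Complex.abs_re_le_norm b).trans (by linarith)
  have hb1 : |(b + 1).re| ≤ M + 1 := (Complex.abs_re_le_norm _).trans <|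
    (norm_add_le _ _).trans (by simpa using hb)
  have e1 : 1 - (a + 1 + b).re = -(a + b).re := by simp; ring
  have e2 : 1 - (a + (b + 1)).re = -(a + b).re := by simp; ring
  have h1 := norm_kernTail_le_of_le hδ (a := a + 1) (b := b)
    (by linarith) hb' abs_fract_le_one hν hc hνc
  have h2 := norm_kernTail_le_of_le hδ (a := a) (b := b + 1)
    (by linarith) hb1 abs_fract_le_one hν hc hνc
  have h3 := norm_kern_le_of_le (a := a) hb' hν hc hνc
  rw [e1] at h1
  rw [e2] at h2
  have hf : ‖((Int.fract c : ℝ) : ℂ)‖ ≤ 1 := by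
    rw [Complex.norm_real]; exact abs_fract_le_one c
  calc ‖kernRem a b ν c‖ ≤ ‖((Int.fract c : ℝ) : ℂ)‖ * ‖kern a b ν c‖ +
        (‖a‖ * ‖kernTail Int.fract (a + 1) b ν c‖ + ‖b‖ * ‖kernTail Int.fract a (b + 1) ν c‖) := by
        rw [kernRem, ← norm_mul, ← norm_neg a, ← norm_mul, ← norm_mul]
        exact (norm_add_le _ _).trans (add_le_add_right (norm_sub_le _ _) _)
    _ ≤ 1 * (2 ^ (M + 1) * c ^ (-(a + b).re)) +
        (M * (2 ^ (M + 1) / δ * c ^ (-(a + b).re)) +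
          M * (2 ^ (M + 1) / δ * c ^ (-(a + b).re))) := by gcongr
    _ = _ := by ring

lemma norm_kernMain_le {a b : ℂ} {δ M : ℝ} (hδ : 0 < δ) (hab : δ ≤ (a + b).re)
    (hab1 : δ ≤ ‖a + b - 1‖) (hb : ‖b‖ ≤ M) {ν c : ℝ} (hν : 0 ≤ ν)
    (hc : 0 < c) (hνc : ν ≤ c) :
    ‖kernMain a b ν c‖ ≤ 2 ^ (M + 1) * (1 + M / δ) / δ * c ^ (1 - (a + b).re) := by
  have hM : 0 ≤ M := (norm_nonneg b).trans hb
  have hb' : |b.re| ≤ M + 1 := (Complex.abs_re_le_norm b).trans (by linarith)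
  have hb1 : |(b + 1).re| ≤ M + 1 := (Complex.abs_re_le_norm _).trans <|
    (norm_add_le _ _).trans (by simpa using hb)
  have e1 : -(a - 1 + b).re = 1 - (a + b).re := by simp; ring
  have e2 : 1 - (a + (b + 1)).re = -(a + b).re := by simp; ring
  have h1 := norm_kern_le_of_le (a := a - 1) hb' hν hc hνc
  have h2 := norm_kernTail_le_of_le hδ (a := a) (b := b + 1) (w := fun _ => 1)
    (by linarith) hb1 (by simp) hν hc hνc
  rw [e1] at h1
  rw [e2] at h2
  have e3 : c ^ (1 - (a + b).re) = c * c ^ (-(a + b).re) := by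
    rw [sub_eq_add_neg, Real.rpow_add hc, Real.rpow_one]
  have hn : ‖(ν : ℂ)‖ ≤ c := by
    rw [Complex.norm_real, Real.norm_eq_abs, abs_of_nonneg hν]; exact hνc
  calc ‖kernMain a b ν c‖ ≤ ‖kern (a - 1) b ν c‖ / ‖a + b - 1‖ +
        ‖b‖ * ‖(ν : ℂ)‖ / ‖a + b - 1‖ * ‖kernTail (fun _ => 1) a (b + 1) ν c‖ := by
        rw [kernMain, ← norm_div, ← norm_mul, ← norm_div, ← norm_mul]
        exact norm_add_le _ _
    _ ≤ (2 ^ (M + 1) * c ^ (1 - (a + b).re)) / δ +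
        M * c / δ * (2 ^ (M + 1) / δ * c ^ (-(a + b).re)) := by gcongr
    _ = _ := by rw [e3]; ring

/-- The constant grows with the bound `M` for the exponents. This suffices for convergence and
holomorphy; the error term needs the sharper `exists_norm_kernRem_le`. -/
lemma norm_kernSum_le {a b : ℂ} {δ M : ℝ} (hδ : 0 < δ) (hab : δ ≤ (a + b).re)
    (hab1 : δ ≤ ‖a + b - 1‖) (ha : ‖a‖ ≤ M) (hb : ‖b‖ ≤ M) {ν c : ℝ} (hν : 0 ≤ ν)
    (hc : 1 ≤ c) (hνc : ν ≤ c) :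
    ‖kernSum a b ν c‖ ≤ 2 ^ (M + 1) * ((1 + M / δ) / δ + (1 + 2 * M / δ)) *
      c ^ (1 - (a + b).re) := by
  have hc0 : 0 < c := by linarith
  have hM : 0 ≤ M := (norm_nonneg b).trans hb
  have h1 := norm_kernMain_le hδ hab hab1 hb hν hc0 hνc
  have h2 := norm_kernRem_le hδ hab ha hb hν hc0 hνc
  have h3 : c ^ (-(a + b).re) ≤ c ^ (1 - (a + b).re) :=
    Real.rpow_le_rpow_of_exponent_le hc (by linarith)
  calc ‖kernSum a b ν c‖ ≤ ‖kernMain a b ν c‖ + ‖kernRem a b ν c‖ := norm_add_le _ _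
    _ ≤ 2 ^ (M + 1) * (1 + M / δ) / δ * c ^ (1 - (a + b).re) +
        2 ^ (M + 1) * (1 + 2 * M / δ) * c ^ (1 - (a + b).re) := by
        refine add_le_add h1 (h2.trans ?_)
        gcongr
    _ = _ := by ring

/-- Fixes the constant of summation: together with `sum_kern` it identifies `kernSum` with the
actual series where that converges. -/
lemma tendsto_kernSum {a b : ℂ} (hab : 1 < (a + b).re) {ν : ℝ} (hν : 0 ≤ ν) :
    Tendsto (kernSum a b ν) atTop (𝓝 0) := by
  set δ : ℝ := min (a + b).re ‖a + b - 1‖ with hδ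
  have hne : a + b - 1 ≠ 0 := fun h => by
    have := congrArg Complex.re h
    simp at this hab
    linarith
  have hδ0 : 0 < δ := lt_min (by linarith) (norm_pos_iff.2 hne)
  have h0 : Tendsto (fun c : ℝ => c ^ (1 - (a + b).re)) atTop (𝓝 0) := by
    have := tendsto_rpow_neg_atTop (sub_pos.2 hab)
    simpa using this
  have h1 := h0.const_mul (2 ^ (max ‖a‖ ‖b‖ + 1) *
    ((1 + max ‖a‖ ‖b‖ / δ) / δ + (1 + 2 * max ‖a‖ ‖b‖ / δ)))
  rw [mul_zero] at h1
  refine squeeze_zero_norm' ?_ h1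
  filter_upwards [eventually_ge_atTop 1, eventually_ge_atTop ν] with c hc1 hcν
  exact norm_kernSum_le hδ0 (min_le_left _ _) (min_le_right _ _) (le_max_left _ _)
    (le_max_right _ _) hν hc1 hcν

/-! ### The continuation as a sum of rows -/

lemma avTerm_eq (s₁ s₂ s₃ : ℂ) (m n : ℕ) :
    avTerm s₁ s₂ s₃ m n = (n : ℂ) ^ (-s₂) * kern s₁ s₃ n m := by
  rw [avTerm, kern, Complex.cpow_neg, Complex.cpow_neg, Complex.cpow_neg]
  simp only [one_div, mul_inv, Complex.ofReal_natCast]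
  ring

lemma avKernel_eq (s₁ s₃ : ℂ) (n : ℕ) (u : ℝ) : avKernel s₁ s₃ n u = kern s₁ (s₃ + 1) n u := by
  rw [avKernel, kern, Complex.cpow_neg, Complex.cpow_neg]
  simp only [one_div, mul_inv, Complex.ofReal_natCast]

lemma avTail_eq (s₁ s₃ : ℂ) (n : ℕ) (a : ℝ) :
    avTail s₁ s₃ n a = kernTail (fun _ => 1) s₁ (s₃ + 1) n a := by
  simp only [avTail, kernTail, avKernel_eq, Complex.ofReal_one, one_mul]

/-- The contribution of `n` to the Apostol-Vu double zeta-function. -/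
noncomputable def avRow (s : ℂ × ℂ × ℂ) (n : ℕ) : ℂ :=
  if n = 0 then 0 else (n : ℂ) ^ (-s.2.1) * kernSum s.1 s.2.2 n n

lemma differentiableAt_kern {p : ℂ × ℂ} {ν c : ℝ} (hν : 0 ≤ ν) (hc : 0 < c) :
    DifferentiableAt ℂ (fun q : ℂ × ℂ => kern q.1 q.2 ν c) p := by
  simp only [kern_eq_exp _ _ hc hν]
  fun_prop

lemma differentiableAt_kernSum {p : ℂ × ℂ} (hp : 0 < (p.1 + p.2).re) (hp1 : p.1 + p.2 ≠ 1)
    {ν c : ℝ} (hν : 0 ≤ ν) (hc : 1 ≤ c) :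
    DifferentiableAt ℂ (fun q : ℂ × ℂ => kernSum q.1 q.2 ν c) p := by
  have hc0 : 0 < c := by linarith
  have h0 : p.1 + p.2 - 1 ≠ 0 := sub_ne_zero.2 hp1
  have e1 : 1 < (p.1 + (p.2 + 1)).re := by
    simp only [Complex.add_re, Complex.one_re] at hp ⊢; linarith
  have e2 : 1 < (p.1 + 1 + p.2).re := by
    simp only [Complex.add_re, Complex.one_re] at hp ⊢; linarith
  have d1 : DifferentiableAt ℂ (fun q : ℂ × ℂ => kern (q.1 - 1) q.2 ν c) p :=
    DifferentiableAt.fun_comp' (g := fun q : ℂ × ℂ => kern q.1 q.2 ν c)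
      (f := fun q : ℂ × ℂ => (q.1 - 1, q.2)) p (differentiableAt_kern hν hc0) (by fun_prop)
  have d2 : DifferentiableAt ℂ (fun q : ℂ × ℂ => kern q.1 q.2 ν c) p :=
    differentiableAt_kern hν hc0
  have d3 : ∀ w : ℝ → ℝ, Measurable w → (∀ u, |w u| ≤ 1) →
      DifferentiableAt ℂ (fun q : ℂ × ℂ => kernTail w q.1 (q.2 + 1) ν c) p := fun w hwm hw =>
    DifferentiableAt.fun_comp' (g := fun q : ℂ × ℂ => kernTail w q.1 q.2 ν c)
      (f := fun q : ℂ × ℂ => (q.1, q.2 + 1)) p (differentiableAt_kernTail e1 hwm hw hν hc)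
      (by fun_prop)
  have d4 : DifferentiableAt ℂ (fun q : ℂ × ℂ => kernTail Int.fract (q.1 + 1) q.2 ν c) p :=
    DifferentiableAt.fun_comp' (g := fun q : ℂ × ℂ => kernTail Int.fract q.1 q.2 ν c)
      (f := fun q : ℂ × ℂ => (q.1 + 1, q.2)) p
      (differentiableAt_kernTail e2 measurable_fract abs_fract_le_one hν hc) (by fun_prop)
  have d5 := d3 _ measurable_const (fun _ => by simp : ∀ u : ℝ, |(fun _ : ℝ => (1 : ℝ)) u| ≤ 1)
  have d6 := d3 _ measurable_fract abs_fract_le_one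
  have f1 : DifferentiableAt ℂ (fun q : ℂ × ℂ => q.1) p := by fun_prop
  have f2 : DifferentiableAt ℂ (fun q : ℂ × ℂ => q.2) p := by fun_prop
  have f4 : DifferentiableAt ℂ (fun q : ℂ × ℂ => (q.1 + q.2 - 1)⁻¹) p :=
    DifferentiableAt.fun_inv (by fun_prop) h0
  simp only [kernSum, kernMain, kernRem, div_eq_mul_inv]
  have d7 := (d1.fun_mul f4).fun_add (((f2.mul_const (ν : ℂ)).fun_mul f4).fun_mul d5)
  have d8 := (d2.const_mul ((Int.fract c : ℝ) : ℂ)).fun_add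
    ((f1.fun_neg.fun_mul d4).fun_sub (f2.fun_mul d6))
  exact d7.fun_add d8

lemma differentiableAt_avRow {s : ℂ × ℂ × ℂ} (hs : s ∈ avDomain) (n : ℕ) :
    DifferentiableAt ℂ (fun s => avRow s n) s := by
  rcases eq_or_ne n 0 with rfl | hn
  · simp [avRow]
  · have h1 : (1 : ℝ) ≤ n := by exact_mod_cast Nat.one_le_iff_ne_zero.2 hn
    simp only [avRow, hn, if_false]
    have hk : DifferentiableAt ℂ (fun s : ℂ × ℂ × ℂ => kernSum s.1 s.2.2 n n) s :=
      DifferentiableAt.fun_comp' (g := fun q : ℂ × ℂ => kernSum q.1 q.2 n n)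
        (f := fun s : ℂ × ℂ × ℂ => (s.1, s.2.2)) s
        (differentiableAt_kernSum (by simpa using hs.1) hs.2.2 (by positivity) h1) (by fun_prop)
    refine DifferentiableAt.mul (DifferentiableAt.const_cpow (by fun_prop) ?_) hk
    exact .inl (by exact_mod_cast hn)

lemma norm_avRow_le {s : ℂ × ℂ × ℂ} {δ M : ℝ} (hδ : 0 < δ) (h1 : δ ≤ s.1.re + s.2.2.re)
    (h2 : δ ≤ ‖s.1 + s.2.2 - 1‖) (hM : ‖s‖ ≤ M) (n : ℕ) :
    ‖avRow s n‖ ≤ 2 ^ (M + 1) * ((1 + M / δ) / δ + (1 + 2 * M / δ)) *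
      (n : ℝ) ^ (1 - (s.1.re + s.2.1.re + s.2.2.re)) := by
  have hM0 : 0 ≤ M := (norm_nonneg s).trans hM
  rcases eq_or_ne n 0 with rfl | hn
  · simp only [avRow, if_true, norm_zero]
    positivity
  · have hn1 : (1 : ℝ) ≤ n := by exact_mod_cast Nat.one_le_iff_ne_zero.2 hn
    have hn0 : (0 : ℝ) < n := by linarith
    have hk := norm_kernSum_le hδ (by simpa using h1) h2 ((norm_fst_le s).trans hM)
      ((norm_snd_le s.2).trans ((norm_snd_le s).trans hM)) hn0.le hn1 le_rfl
    rw [avRow, if_neg hn, norm_mul, Complex.norm_natCast_cpow_of_pos (Nat.pos_of_ne_zero hn),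
      Complex.neg_re]
    have e : (n : ℝ) ^ (1 - (s.1.re + s.2.1.re + s.2.2.re)) =
        (n : ℝ) ^ (-s.2.1.re) * (n : ℝ) ^ (1 - (s.1 + s.2.2).re) := by
      rw [← Real.rpow_add hn0]
      congr 1
      simp
      ring
    rw [e]
    calc _ ≤ (n : ℝ) ^ (-s.2.1.re) * (2 ^ (M + 1) * ((1 + M / δ) / δ + (1 + 2 * M / δ)) *
          (n : ℝ) ^ (1 - (s.1 + s.2.2).re)) := by gcongr
      _ = _ := by ring

lemma exists_pos_lt_of_mem_avDomain {s : ℂ × ℂ × ℂ} (hs : s ∈ avDomain) :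
    ∃ δ : ℝ, 0 < δ ∧ δ < s.1.re + s.2.2.re ∧ 2 + δ < s.1.re + s.2.1.re + s.2.2.re ∧
      δ < ‖s.1 + s.2.2 - 1‖ := by
  have h : 0 < min (s.1.re + s.2.2.re) (min (s.1.re + s.2.1.re + s.2.2.re - 2)
      ‖s.1 + s.2.2 - 1‖) :=
    lt_min hs.1 (lt_min (by linarith [hs.2.1]) (norm_pos_iff.2 (sub_ne_zero.2 hs.2.2)))
  obtain ⟨δ, h0, hδ⟩ := exists_between h
  rw [lt_min_iff, lt_min_iff] at hδ
  exact ⟨δ, h0, hδ.1, by linarith [hδ.2.1], hδ.2.2⟩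

lemma summable_avRow {s : ℂ × ℂ × ℂ} (hs : s ∈ avDomain) : Summable (avRow s) := by
  obtain ⟨δ, h0, h1, h2, h3⟩ := exists_pos_lt_of_mem_avDomain hs
  exact .of_norm_bounded ((Real.summable_nat_rpow.2 (by linarith)).mul_left _)
    (norm_avRow_le h0 h1.le h3.le le_rfl)

lemma differentiableOn_tsum_avRow : DifferentiableOn ℂ (fun s => ∑' n, avRow s n) avDomain := by
  intro s hs
  obtain ⟨δ, h0, h1, h2, h3⟩ := exists_pos_lt_of_mem_avDomain hs
  let V : Set (ℂ × ℂ × ℂ) := avDomain ∩ ({s | δ < s.1.re + s.2.2.re} ∩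
    ({s | 2 + δ < s.1.re + s.2.1.re + s.2.2.re} ∩ ({s | δ < ‖s.1 + s.2.2 - 1‖} ∩
      ball 0 (‖s‖ + 1))))
  have hV : IsOpen V := isOpen_avDomain.inter <| (isOpen_lt (by fun_prop) (by fun_prop)).inter <|
    (isOpen_lt (by fun_prop) (by fun_prop)).inter <|
      (isOpen_lt (by fun_prop) (by fun_prop)).inter isOpen_ball
  have hsV : s ∈ V := ⟨hs, h1, h2, h3, by simp⟩
  have hM : 0 ≤ ‖s‖ := norm_nonneg s
  refine ((differentiableOn_tsum_of_norm_le (u := fun n : ℕ => 2 ^ (‖s‖ + 1 + 1) *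
    ((1 + (‖s‖ + 1) / δ) / δ + (1 + 2 * (‖s‖ + 1) / δ)) * (n : ℝ) ^ (-1 - δ)) hV
    ((Real.summable_nat_rpow.2 (by linarith)).mul_left _)
    (fun n z hz => (differentiableAt_avRow hz.1 n).differentiableWithinAt)
    fun n z hz => ?_).differentiableAt (hV.mem_nhds hsV)).differentiableWithinAt
  obtain ⟨hz0, hz1, hz2, hz3, hz4⟩ := hz
  rcases eq_or_ne n 0 with rfl | hn
  · simp only [avRow, if_true, norm_zero]
    positivity
  have hn1 : (1 : ℝ) ≤ n := by exact_mod_cast Nat.one_le_iff_ne_zero.2 hn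
  refine (norm_avRow_le h0 (le_of_lt hz1) (le_of_lt hz3) (mem_ball_zero_iff.1 hz4).le n).trans ?_
  rw [mem_ofPred_eq] at hz2
  refine mul_le_mul_of_nonneg_left (Real.rpow_le_rpow_of_exponent_le hn1 ?_) (by positivity)
  linarith

lemma hasSum_kern {s₁ s₃ : ℂ} (h1 : 1 < s₁.re) (h3 : 1 < s₃.re) {n : ℕ} (hn : n ≠ 0) :
    HasSum (fun m : ℕ => if n < m then kern s₁ s₃ n m else 0) (kernSum s₁ s₃ n n) := by
  have hab : 1 < (s₁ + s₃).re := by rw [Complex.add_re]; linarith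
  have hne : s₁ + s₃ ≠ 1 := fun h => by rw [h] at hab; simp at hab
  have hs : Summable (fun m : ℕ => if n < m then kern s₁ s₃ n m else 0) := by
    refine .of_norm_bounded (Real.summable_nat_rpow.2 (by linarith : -s₁.re < -1)) fun m => ?_
    split_ifs with h
    · have hm : (0 : ℝ) < m := by exact_mod_cast (Nat.zero_le n).trans_lt h
      have hm1 : (1 : ℝ) ≤ m := by exact_mod_cast (Nat.zero_le n).trans_lt h
      rw [norm_kern s₁ s₃ hm (Nat.cast_nonneg n)]
      refine mul_le_of_le_one_right (by positivity) (Real.rpow_le_one_of_one_le_of_nonpos ?_ ?_)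
      · linarith [(Nat.cast_nonneg n : (0 : ℝ) ≤ n)]
      · linarith
    · simp only [norm_zero]; positivity
  rw [hs.hasSum_iff_tendsto_nat, ← tendsto_add_atTop_iff_nat 1]
  have hl : Tendsto (fun N : ℕ => kernSum s₁ s₃ n n - kernSum s₁ s₃ n N) atTop
      (𝓝 (kernSum s₁ s₃ n n - 0)) :=
    ((tendsto_kernSum hab (Nat.cast_nonneg n)).comp tendsto_natCast_atTop_atTop).const_sub _
  rw [sub_zero] at hl
  refine hl.congr' ?_
  filter_upwards [eventually_ge_atTop n] with N hN
  rw [← sum_kern (by linarith) hne (Nat.cast_nonneg n)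
    (by exact_mod_cast Nat.pos_of_ne_zero hn) (by exact_mod_cast hN), ← Finset.sum_filter,
    Nat.floor_natCast, Nat.floor_natCast]
  congr 1
  ext m
  simp
  omega

lemma isAVContinuation_tsum_avRow : IsAVContinuation (fun s => ∑' n, avRow s n) := by
  refine ⟨differentiableOn_tsum_avRow, fun s₁ s₂ s₃ h1 h2 h3 => ?_⟩
  have hs : (s₁, s₂, s₃) ∈ avDomain := by
    refine ⟨by simp only; linarith, by simp only; linarith, fun h => ?_⟩
    have := congrArg Complex.re h
    simp at this
    linarith
  -- The terms extended by zero to all pairs. Absolute summability lets the sum by `m`, which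
  -- defines the function, be exchanged for the sum by `n`, which gives the rows.
  let g : ℕ × ℕ → ℂ := fun p => if p.2 ≠ 0 ∧ p.2 < p.1 then avTerm s₁ s₂ s₃ p.1 p.2 else 0
  have hg : Summable g := by
    refine .of_norm_bounded (g := fun p : ℕ × ℕ => (p.1 : ℝ) ^ (-s₁.re) * (p.2 : ℝ) ^ (-s₂.re))
      (Summable.mul_of_nonneg (Real.summable_nat_rpow.2 (by linarith : -s₁.re < -1))
        (Real.summable_nat_rpow.2 (by linarith : -s₂.re < -1))
        (fun _ => by positivity) (fun _ => by positivity)) ?_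
    rintro ⟨m, n⟩
    simp only [g]
    split_ifs with h
    · have hm : (0 : ℝ) < m := by exact_mod_cast (Nat.zero_le n).trans_lt h.2
      have hm1 : (1 : ℝ) ≤ m := by exact_mod_cast (Nat.zero_le n).trans_lt h.2
      rw [avTerm_eq, norm_mul, Complex.norm_natCast_cpow_of_pos (Nat.pos_of_ne_zero h.1),
        Complex.neg_re, mul_comm, norm_kern s₁ s₃ hm (Nat.cast_nonneg n)]
      gcongr
      refine mul_le_of_le_one_right (by positivity) (Real.rpow_le_one_of_one_le_of_nonpos ?_ ?_)
      · linarith [(Nat.cast_nonneg n : (0 : ℝ) ≤ n)]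
      · linarith
    · simp only [norm_zero]; positivity
  have hcol : ∀ n, HasSum (fun m => g (m, n)) (avRow (s₁, s₂, s₃) n) := by
    intro n
    rcases eq_or_ne n 0 with rfl | hn
    · simp [g, avRow, hasSum_zero]
    · simp only [g, avRow, hn, ne_eq, not_false_eq_true, true_and, if_false]
      refine ((hasSum_kern h1 h3 hn).mul_left ((n : ℂ) ^ (-s₂))).congr_fun fun m => ?_
      rw [avTerm_eq, mul_ite, mul_zero]
  have hrow : ∀ m, HasSum (fun n => g (m, n)) (∑ n ∈ Finset.Ico 1 m, avTerm s₁ s₂ s₃ m n) := by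
    intro m
    have : ∑ n ∈ Finset.Ico 1 m, avTerm s₁ s₂ s₃ m n = ∑ n ∈ Finset.Ico 1 m, g (m, n) := by
      refine Finset.sum_congr rfl fun n hn => ?_
      rw [Finset.mem_Ico] at hn
      simp only [g]
      rw [if_pos ⟨by omega, hn.2⟩]
    rw [this]
    refine hasSum_sum_of_ne_finset_zero fun n hn => ?_
    simp only [g]
    rw [if_neg]
    rw [Finset.mem_Ico] at hn
    omega
  have h4 := hg.hasSum.prod_fiberwise hrow
  have h5 := (hg.prod_symm.hasSum).prod_fiberwise hcol
  rw [← (Equiv.prodComm ℕ ℕ).tsum_eq g] at h4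
  simp only [h5.tsum_eq]
  exact h4

lemma isAVContinuation_zetaAV : IsAVContinuation (fun s => zetaAV s.1 s.2.1 s.2.2) := by
  have h : ∃ F, IsAVContinuation F := ⟨_, isAVContinuation_tsum_avRow⟩
  simp only [zetaAV, dif_pos h]
  exact h.choose_spec

lemma hasSum_avRow {s₁ s₂ s₃ : ℂ} (hs : (s₁, s₂, s₃) ∈ avDomain) :
    HasSum (avRow (s₁, s₂, s₃)) (zetaAV s₁ s₂ s₃) := by
  have h : zetaAV s₁ s₂ s₃ = _ := isAVContinuation_zetaAV.eqOn isAVContinuation_tsum_avRow hs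
  rw [h]
  exact (summable_avRow hs).hasSum

/-! ### The periodic phase correction -/

/-- The entire function `(1 - e^{-z}) / z`. -/
noncomputable def expQuot : ℂ → ℂ := dslope (fun z => 1 - Complex.exp (-z)) 0

/-- The entire function `(1 - expQuot z) / z`. -/
noncomputable def expQuot₂ : ℂ → ℂ := dslope (fun z => 1 - expQuot z) 0

lemma differentiable_dslope {f : ℂ → ℂ} (hf : Differentiable ℂ f) (c : ℂ) :
    Differentiable ℂ (dslope f c) := by
  rw [← differentiableOn_univ] at hf ⊢
  exact (Complex.differentiableOn_dslope univ_mem).2 hf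

lemma differentiable_expQuot : Differentiable ℂ expQuot :=
  differentiable_dslope (by fun_prop) 0

lemma differentiable_expQuot₂ : Differentiable ℂ expQuot₂ :=
  differentiable_dslope (differentiable_expQuot.const_sub 1) 0

lemma mul_expQuot (z : ℂ) : z * expQuot z = 1 - Complex.exp (-z) := by
  have := sub_smul_dslope (fun z => 1 - Complex.exp (-z)) 0 z
  simpa [expQuot] using this

lemma expQuot_zero : expQuot 0 = 1 := by
  rw [expQuot, dslope_same]
  have h : HasDerivAt (fun z : ℂ => 1 - Complex.exp (-z)) (-(Complex.exp (-0) * -1)) 0 :=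
    (hasDerivAt_neg (0 : ℂ)).cexp.const_sub 1
  rw [h.deriv]
  simp

lemma mul_expQuot₂ (z : ℂ) : z * expQuot₂ z = 1 - expQuot z := by
  have := sub_smul_dslope (fun z => 1 - expQuot z) 0 z
  simpa [expQuot_zero, expQuot₂] using this

lemma mul_deriv_expQuot (z : ℂ) : z * deriv expQuot z = Complex.exp (-z) - expQuot z := by
  have h1 : HasDerivAt (fun z : ℂ => z * expQuot z) (1 * expQuot z + z * deriv expQuot z) z :=
    (hasDerivAt_id z).mul (differentiable_expQuot z).hasDerivAt
  have h2 : HasDerivAt (fun z : ℂ => 1 - Complex.exp (-z)) (-(Complex.exp (-z) * -1)) z :=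
    (hasDerivAt_neg z).cexp.const_sub 1
  simp only [mul_expQuot] at h1
  have := h1.unique h2
  linear_combination this

/-- The zeros of 1 - e^(-z) are the multiples of 2πi, and the one at 0 is removed by the division.
This is where the bound 2π on the phase is needed. -/
lemma expQuot_ne_zero {θ : ℝ} (hθ : |θ| < 2 * Real.pi) : expQuot (Complex.I * θ) ≠ 0 := by
  intro h
  have h1 := mul_expQuot (Complex.I * θ)
  rw [h, mul_zero, eq_comm, sub_eq_zero, eq_comm, Complex.exp_eq_one_iff] at h1
  obtain ⟨n, hn⟩ := h1
  have h2 : -θ = n * (2 * Real.pi) := by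
    have := congrArg Complex.im hn
    simpa using this
  rcases eq_or_ne n 0 with rfl | hn0
  · have : θ = 0 := by simpa using h2
    rw [this, Complex.ofReal_zero, mul_zero, expQuot_zero] at h
    exact one_ne_zero h
  · have h3 : (1 : ℝ) ≤ |(n : ℝ)| := by exact_mod_cast Int.one_le_abs hn0
    rw [← abs_neg, h2, abs_mul, abs_of_pos Real.two_pi_pos] at hθ
    nlinarith [Real.two_pi_pos]

/-- The periodic solution `v ↦ p v θ` of `p' + iθp = iθv` on `[0, 1]`. -/
noncomputable def phaseCorr (v θ : ℝ) : ℂ :=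
  v - v * expQuot (Complex.I * θ * v) / expQuot (Complex.I * θ) +
    expQuot₂ (Complex.I * θ) / expQuot (Complex.I * θ)

/-- The derivative of `phaseCorr v θ` with respect to `θ`. -/
noncomputable def phaseCorrDeriv (v θ : ℝ) : ℂ :=
  Complex.I * (-(v ^ 2 * deriv expQuot (Complex.I * θ * v) / expQuot (Complex.I * θ)) +
    v * expQuot (Complex.I * θ * v) * deriv expQuot (Complex.I * θ) /
      expQuot (Complex.I * θ) ^ 2 +
    (deriv expQuot₂ (Complex.I * θ) * expQuot (Complex.I * θ) -
      expQuot₂ (Complex.I * θ) * deriv expQuot (Complex.I * θ)) / expQuot (Complex.I * θ) ^ 2)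

/-- For θ ≠ 0 the correction equals v - 1/(iθ) + e^(-iθv)/(1 - e^(-iθ)); the coefficient of the
exponential is the one that yields this equality. The form through `expQuot` and `expQuot₂` removes
the singularity at θ = 0. -/
lemma phaseCorr_zero_eq_one {θ : ℝ} (hθ : |θ| < 2 * Real.pi) :
    phaseCorr 0 θ = phaseCorr 1 θ := by
  have := expQuot_ne_zero hθ
  simp only [phaseCorr, Complex.ofReal_zero, Complex.ofReal_one, mul_one, zero_mul, zero_div,
    one_mul, div_self this]
  ring

lemma continuousOn_phaseCorr :
    ContinuousOn (fun p : ℝ × ℝ => phaseCorr p.1 p.2) {p | |p.2| < 2 * Real.pi} := by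
  have h1 := differentiable_expQuot.continuous
  have h2 := differentiable_expQuot₂.continuous
  unfold phaseCorr
  refine .add (.sub (by fun_prop) (.div (by fun_prop) (by fun_prop) ?_))
    (.div (by fun_prop) (by fun_prop) ?_)
  all_goals exact fun p hp => expQuot_ne_zero hp

lemma continuousOn_phaseCorrDeriv :
    ContinuousOn (fun p : ℝ × ℝ => phaseCorrDeriv p.1 p.2) {p | |p.2| < 2 * Real.pi} := by
  have h1 := differentiable_expQuot.continuous
  have h2 := differentiable_expQuot₂.continuous
  have h3 : Continuous (deriv expQuot) :=
    (differentiable_expQuot.contDiff (n := 1)).continuous_deriv le_rfl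
  have h4 : Continuous (deriv expQuot₂) :=
    (differentiable_expQuot₂.contDiff (n := 1)).continuous_deriv le_rfl
  unfold phaseCorrDeriv
  refine .mul (by fun_prop) (.add (.add (.neg (.div (by fun_prop) (by fun_prop) ?_))
    (.div (by fun_prop) (by fun_prop) ?_)) (.div (by fun_prop) (by fun_prop) ?_))
  · exact fun p hp => expQuot_ne_zero hp
  · exact fun p hp => pow_ne_zero 2 (expQuot_ne_zero hp)
  · exact fun p hp => pow_ne_zero 2 (expQuot_ne_zero hp)

lemma exists_norm_phaseCorr_le {ρ : ℝ} (hρ : ρ < 2 * Real.pi) :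
    ∃ K : ℝ, 0 ≤ K ∧ ∀ v ∈ Icc (0 : ℝ) 1, ∀ θ : ℝ, |θ| ≤ ρ →
      ‖phaseCorr v θ‖ ≤ K ∧ ‖phaseCorrDeriv v θ‖ ≤ K := by
  have hc : IsCompact (Icc (0 : ℝ) 1 ×ˢ Icc (-ρ) ρ) := isCompact_Icc.prod isCompact_Icc
  have hs : Icc (0 : ℝ) 1 ×ˢ Icc (-ρ) ρ ⊆ {p | |p.2| < 2 * Real.pi} := fun p hp =>
    (abs_le.2 hp.2).trans_lt hρ
  obtain ⟨K₁, h1⟩ := hc.exists_bound_of_continuousOn (continuousOn_phaseCorr.mono hs)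
  obtain ⟨K₂, h2⟩ := hc.exists_bound_of_continuousOn (continuousOn_phaseCorrDeriv.mono hs)
  refine ⟨max 0 (max K₁ K₂), le_max_left _ _, fun v hv θ hθ => ?_⟩
  have hm : (v, θ) ∈ Icc (0 : ℝ) 1 ×ˢ Icc (-ρ) ρ := ⟨hv, abs_le.1 hθ⟩
  exact ⟨(h1 _ hm).trans ((le_max_left _ _).trans (le_max_right _ _)),
    (h2 _ hm).trans ((le_max_right _ _).trans (le_max_right _ _))⟩

/-- The first two terms are the differential equation for fixed phase; the last accounts for the
variation of the phase. -/
lemma hasDerivAt_phaseCorr {θ : ℝ → ℝ} {θ' u m : ℝ} (hθ : HasDerivAt θ θ' u)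
    (hlt : |θ u| < 2 * Real.pi) :
    HasDerivAt (fun t => phaseCorr (t - m) (θ t))
      (Complex.I * θ u * (u - m) - Complex.I * θ u * phaseCorr (u - m) (θ u) +
        θ' * phaseCorrDeriv (u - m) (θ u)) u := by
  have hq := expQuot_ne_zero hlt
  have hv : HasDerivAt (fun t : ℝ => ((t - m : ℝ) : ℂ)) 1 u := by
    simpa using ((hasDerivAt_id u).sub_const m).ofReal_comp
  have hw : HasDerivAt (fun t : ℝ => Complex.I * (θ t : ℂ)) (Complex.I * θ') u :=
    hθ.ofReal_comp.const_mul _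
  have c1 : HasDerivAt (fun t => expQuot (Complex.I * θ t))
      (deriv expQuot (Complex.I * θ u) * (Complex.I * θ')) u :=
    HasDerivAt.comp u (differentiable_expQuot _).hasDerivAt hw
  have c2 : HasDerivAt (fun t => expQuot₂ (Complex.I * θ t))
      (deriv expQuot₂ (Complex.I * θ u) * (Complex.I * θ')) u :=
    HasDerivAt.comp u (differentiable_expQuot₂ _).hasDerivAt hw
  have c3 : HasDerivAt (fun t => expQuot (Complex.I * θ t * (t - m : ℝ)))
      (deriv expQuot (Complex.I * θ u * (u - m : ℝ)) *
        (Complex.I * θ' * (u - m : ℝ) + Complex.I * θ u * 1)) u :=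
    HasDerivAt.comp u (differentiable_expQuot _).hasDerivAt (hw.mul hv)
  have h := (hv.sub ((hv.mul c3).div c1 hq)).add (c2.div c1 hq)
  refine h.congr_deriv ?_
  have e1 := mul_deriv_expQuot (Complex.I * θ u * (u - m : ℝ))
  have e2 := mul_expQuot (Complex.I * θ u * (u - m : ℝ))
  have e3 := mul_expQuot₂ (Complex.I * θ u)
  simp only [phaseCorr, phaseCorrDeriv, Pi.mul_apply] at *
  push_cast at *
  generalize expQuot (Complex.I * θ u) = Q at *
  generalize expQuot₂ (Complex.I * θ u) = R at *
  generalize expQuot (Complex.I * θ u * (u - m)) = Qv at *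
  generalize deriv expQuot (Complex.I * θ u * (u - m)) = Qv' at *
  generalize deriv expQuot (Complex.I * θ u) = Q' at *
  generalize deriv expQuot₂ (Complex.I * θ u) = R' at *
  generalize Complex.exp _ = X at *
  field_simp
  linear_combination -Q * e1 - Q * e2 + Q * e3

/-! ### The remainder bound uniform in the phase -/

lemma fract_eventuallyEq_nhdsGE (u : ℝ) : ∀ᶠ t in 𝓝[≥] u, Int.fract t = t - (⌊u⌋ : ℝ) := by
  filter_upwards [self_mem_nhdsWithin,
    mem_nhdsWithin_of_mem_nhds (Iio_mem_nhds (Int.lt_floor_add_one u))] with t ht ht'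
  have : ⌊t⌋ = ⌊u⌋ := Int.floor_eq_iff.2 ⟨(Int.floor_le u).trans ht, ht'⟩
  rw [Int.fract, this]

/-- The derivative of the argument of `kern a b ν`. -/
noncomputable def kernPhase (a b : ℂ) (ν u : ℝ) : ℝ := -(a.im / u + b.im / (u + ν))

lemma hasDerivAt_kernPhase (a b : ℂ) {ν u : ℝ} (hu : 0 < u) (hν : 0 ≤ ν) :
    HasDerivAt (kernPhase a b ν) (a.im / u ^ 2 + b.im / (u + ν) ^ 2) u := by
  have h2 : u + ν ≠ 0 := by positivity
  have h := (((hasDerivAt_inv hu.ne').const_mul a.im).add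
    ((((hasDerivAt_id u).add_const ν).inv h2).const_mul b.im)).neg
  refine (h.congr_deriv ?_).congr_of_eventuallyEq (.of_forall fun t => ?_)
  · simp
    ring
  · simp [kernPhase]
    ring

lemma abs_kernPhase_le (a b : ℂ) {ν c u : ℝ} (hc : 0 < c) (hu : c ≤ u) (hν : 0 ≤ ν) :
    |kernPhase a b ν u| ≤ (|a.im| + |b.im|) / c := by
  have hu0 : 0 < u := hc.trans_le hu
  have h2 : 0 < u + ν := by positivity
  rw [kernPhase, abs_neg, add_div]
  refine (abs_add_le _ _).trans ?_
  rw [abs_div, abs_div, abs_of_pos hu0, abs_of_pos h2]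
  gcongr
  linarith

lemma kern_deriv_eq (a b : ℂ) {ν u : ℝ} (hu : 0 < u) (hν : 0 ≤ ν) :
    -a * kern (a + 1) b ν u - b * kern a (b + 1) ν u =
      (-(a.re / u + b.re / (u + ν) : ℝ) + Complex.I * kernPhase a b ν u) * kern a b ν u := by
  have h1 : (u : ℂ) ≠ 0 := by exact_mod_cast hu.ne'
  have h2 : (u : ℂ) + ν ≠ 0 := by exact_mod_cast (by positivity : u + ν ≠ 0)
  rw [kern_add_one_left a b hu, kern_add_one_right a b hu hν, kernPhase]
  nth_rewrite 1 [← Complex.re_add_im a]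
  nth_rewrite 2 [← Complex.re_add_im b]
  push_cast
  field_simp
  ring

lemma hasDerivAt_norm_kern (a b : ℂ) {ν u : ℝ} (hu : 0 < u) (hν : 0 ≤ ν) :
    HasDerivAt (fun u => ‖kern a b ν u‖)
      (-(a.re / u + b.re / (u + ν)) * ‖kern a b ν u‖) u := by
  have h2 : u + ν ≠ 0 := by positivity
  have h : ∀ t : ℝ, 0 < t → ‖kern a b ν t‖ =
      Real.exp (-a.re * Real.log t - b.re * Real.log (t + ν)) := fun t ht => by
    rw [kern_eq_exp a b ht hν, Complex.norm_exp]
    simp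
  have h1 : HasDerivAt (fun t : ℝ => Real.exp (-a.re * Real.log t - b.re * Real.log (t + ν)))
      (Real.exp (-a.re * Real.log u - b.re * Real.log (u + ν)) *
        (-a.re * u⁻¹ - b.re * (1 / (u + ν)))) u :=
    HasDerivAt.exp (((Real.hasDerivAt_log hu.ne').const_mul _).sub
      ((((hasDerivAt_id u).add_const ν).log h2).const_mul _))
  refine (h1.congr_deriv ?_).congr_of_eventuallyEq ?_
  · rw [h u hu]
    ring
  · filter_upwards [lt_mem_nhds hu] with t ht using h t ht

lemma norm_kern_antitone {a b : ℂ} (ha : 0 ≤ a.re) (hb : 0 ≤ b.re) {ν c d : ℝ} (hν : 0 ≤ ν)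
    (hc : 0 < c) (hcd : c ≤ d) : ‖kern a b ν d‖ ≤ ‖kern a b ν c‖ := by
  rw [norm_kern a b hc hν, norm_kern a b (hc.trans_le hcd) hν]
  exact mul_le_mul (Real.rpow_le_rpow_of_nonpos hc hcd (by linarith))
    (Real.rpow_le_rpow_of_nonpos (by positivity) (by linarith) (by linarith))
    (by have := hc.trans_le hcd; positivity) (by positivity)

/-- Periodicity of the correction cancels the jumps of the fractional part. The `max u c` keeps the
phase below 2π for every real `u`, so that continuity holds globally. -/
lemma continuous_phaseCorr_fract (a b : ℂ) {ν c : ℝ} (hν : 0 ≤ ν) (hc : 0 < c)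
    (h : (|a.im| + |b.im|) / c < 2 * Real.pi) :
    Continuous fun u : ℝ => phaseCorr (Int.fract u) (kernPhase a b ν (max u c)) := by
  have hlt : ∀ u, |kernPhase a b ν (max u c)| < 2 * Real.pi := fun u =>
    (abs_kernPhase_le a b hc (le_max_right u c) hν).trans_lt h
  have hθ : Continuous fun u : ℝ => kernPhase a b ν (max u c) :=
    continuous_iff_continuousAt.2 fun u =>
      (hasDerivAt_kernPhase a b (hc.trans_le (le_max_right u c)) hν).continuousAt.comp_of_eq
        (by fun_prop : Continuous fun u : ℝ => max u c).continuousAt rfl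
  refine ContinuousOn.comp_fract (s := fun u : ℝ => u)
    (f := fun u v : ℝ => phaseCorr v (kernPhase a b ν (max u c))) ?_ continuous_id
    fun u => phaseCorr_zero_eq_one (hlt u)
  exact (continuousOn_phaseCorr.comp
    (continuous_snd.prodMk (hθ.comp continuous_fst)).continuousOn
    fun p _ => hlt p.1)

/-- After subtraction of the corrected kernel `H`, the primitive has derivative (-α{u} - θ'D + αp)
times the kernel, in which the large phase no longer appears undifferentiated as a factor. Here p is
the correction and D its derivative in θ. -/
lemma norm_integral_fract_mul_deriv_kern_le {ρ K : ℝ} (hρ : ρ < 2 * Real.pi) (hK0 : 0 ≤ K)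
    (hK : ∀ v ∈ Icc (0 : ℝ) 1, ∀ θ : ℝ, |θ| ≤ ρ →
      ‖phaseCorr v θ‖ ≤ K ∧ ‖phaseCorrDeriv v θ‖ ≤ K)
    {a b : ℂ} (ha : 0 ≤ a.re) (hb : 0 ≤ b.re) {ν c d : ℝ} (hν : 0 ≤ ν)
    (hc : 0 < c) (hcd : c ≤ d) (hab : (|a.im| + |b.im|) / c ≤ ρ) :
    ‖∫ u in c..d, ((Int.fract u : ℝ) : ℂ) *
      (-a * kern (a + 1) b ν u - b * kern a (b + 1) ν u)‖ ≤
      (1 + 3 * K + K * ρ) * ‖kern a b ν c‖ := by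
  have hlt := hab.trans_lt hρ
  set k' : ℝ → ℂ := fun u => -a * kern (a + 1) b ν u - b * kern a (b + 1) ν u with hk'
  set A : ℝ → ℝ := fun u => ‖kern a b ν u‖ with hA
  have hpos : ∀ {u}, c ≤ u → 0 < u := fun h => hc.trans_le h
  have hmem : ∀ u : ℝ, Int.fract u ∈ Icc (0 : ℝ) 1 := fun u =>
    ⟨Int.fract_nonneg u, (Int.fract_lt_one u).le⟩
  have hθ : ∀ {u}, c ≤ u → |kernPhase a b ν u| ≤ ρ := fun h =>
    (abs_kernPhase_le a b hc h hν).trans hab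
  have hk'c : ContinuousOn k' (Ioi 0) :=
    (continuousOn_const.mul (continuousOn_kern _ _ hν)).sub
      (continuousOn_const.mul (continuousOn_kern _ _ hν))
  have hk'm : Measurable k' :=
    (measurable_const.mul (measurable_kern _ _ _)).sub
      (measurable_const.mul (measurable_kern _ _ _))
  have hfm : Measurable fun u : ℝ => ((Int.fract u : ℝ) : ℂ) * k' u :=
    (Complex.measurable_ofReal.comp measurable_fract).mul hk'm
  have hfi : ∀ {u}, c ≤ u →
      IntervalIntegrable (fun u : ℝ => ((Int.fract u : ℝ) : ℂ) * k' u) volume c u := by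
    intro u hu
    have hi : IntervalIntegrable k' volume c u := (hk'c.mono fun t ht => by
      rw [uIcc_of_le hu] at ht
      exact hpos ht.1).intervalIntegrable
    refine hi.mono_fun hfm.aestronglyMeasurable (.of_forall fun t => ?_)
    simp only [norm_mul, Complex.norm_real]
    exact mul_le_of_le_one_left (norm_nonneg _) (abs_fract_le_one t)
  let H : ℝ → ℂ := fun u =>
    phaseCorr (Int.fract u) (kernPhase a b ν (max u c)) * kern a b ν u
  let G : ℝ → ℂ := fun u => (∫ t in c..u, ((Int.fract t : ℝ) : ℂ) * k' t) - H u
  have hH : ∀ {u}, c ≤ u → ‖H u‖ ≤ K * A u := fun {u} hu => by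
    simp only [H, max_eq_left hu, norm_mul]
    gcongr
    exact (hK _ (hmem u) _ (hθ hu)).1
  let D : ℝ → ℂ := fun u => phaseCorrDeriv (Int.fract u) (kernPhase a b ν u)
  let α : ℝ → ℝ := fun u => a.re / u + b.re / (u + ν)
  let τ : ℝ → ℝ := fun u => a.im / u ^ 2 + b.im / (u + ν) ^ 2
  let G' : ℝ → ℂ := fun u =>
    (-(Int.fract u : ℝ) * α u - τ u * D u +
      α u * phaseCorr (Int.fract u) (kernPhase a b ν u)) * kern a b ν u
  -- A majorant known in closed form: the derivative of -`A` is α`A`, which pays for the terms with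
  -- α, and the reciprocals integrate the bound for |θ'|, with `A u` replaced by its maximum `A c`.
  let B : ℝ → ℝ := fun u => -(1 + K) * A u -
    K * A c * (|a.im| * u⁻¹ + |b.im| * (u + ν)⁻¹)
  let B' : ℝ → ℝ := fun u => -(1 + K) * (-α u * A u) -
    K * A c * (|a.im| * (-(u ^ 2)⁻¹) + |b.im| * (-1 / (u + ν) ^ 2))
  have hGc : ContinuousOn G (Icc c d) := by
    refine .sub ?_ ((continuous_phaseCorr_fract a b hν hc hlt).continuousOn.mul
      ((continuousOn_kern a b hν).mono fun u hu => hpos hu.1))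
    have := intervalIntegral.continuousOn_primitive_interval'
      (hfi hcd) (left_mem_uIcc)
    rwa [uIcc_of_le hcd] at this
  -- Only right derivatives exist at integers, where the fractional part jumps; with continuity of
  -- `G` they suffice for the comparison with `B`.
  have hG' : ∀ u ∈ Ico c d, HasDerivWithinAt G (G' u) (Ici u) u := by
    intro u hu
    have hu0 := hpos hu.1
    have hfr := fract_eventuallyEq_nhdsGE u
    have i1 : HasDerivWithinAt (fun u => ∫ t in c..u, ((Int.fract t : ℝ) : ℂ) * k' t)
        ((Int.fract u : ℝ) * k' u) (Ici u) u := by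
      refine intervalIntegral.integral_hasDerivWithinAt_right (hfi hu.1) (t := Ioi u)
        hfm.stronglyMeasurable.stronglyMeasurableAtFilter ?_
      refine .mul ?_ ((hk'c.continuousAt (Ioi_mem_nhds hu0)).continuousWithinAt)
      have e1 : ContinuousWithinAt (fun t : ℝ => ((t - ⌊u⌋ : ℝ) : ℂ)) (Ioi u) u := by fun_prop
      refine e1.congr_of_eventuallyEq ?_ (by rw [Int.self_sub_floor])
      filter_upwards [hfr.filter_mono (nhdsWithin_mono _ Ioi_subset_Ici_self)] with t ht
      rw [ht]
    have i2 := (hasDerivAt_phaseCorr (m := ⌊u⌋) (hasDerivAt_kernPhase a b hu0 hν)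
      ((hθ hu.1).trans_lt hρ)).hasDerivWithinAt (s := Ici u)
    have i3 := i2.mul (hasDerivAt_kern a b hu0 hν).hasDerivWithinAt
    have i4 := i3.congr_of_eventuallyEq (f₁ := H) ?_ ?_
    rotate_left
    · filter_upwards [hfr, self_mem_nhdsWithin] with t ht htu
      simp only [H, Pi.mul_apply, max_eq_left (hu.1.trans htu), ht]
    · simp only [H, Pi.mul_apply, max_eq_left hu.1, Int.self_sub_floor]
    refine (i1.sub i4).congr_deriv ?_
    simp only [G', hk', kern_deriv_eq a b hu0 hν, D, α, τ]
    rw [show (u : ℂ) - ((⌊u⌋ : ℝ) : ℂ) = ((Int.fract u : ℝ) : ℂ) by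
      rw [← Int.self_sub_floor, Complex.ofReal_sub], Int.self_sub_floor]
    push_cast
    ring
  have hBd : ∀ u ∈ Icc c d, HasDerivAt B (B' u) u := by
    intro u hu
    have hu0 := hpos hu.1
    have h2 : u + ν ≠ 0 := by positivity
    exact ((hasDerivAt_norm_kern a b hu0 hν).const_mul _).sub
      ((((hasDerivAt_inv hu0.ne').const_mul _).add
        ((((hasDerivAt_id u).add_const ν).inv h2).const_mul _)).const_mul _)
  have hbound : ∀ u ∈ Ico c d, ‖G' u‖ ≤ B' u := by
    intro u hu
    have hu0 := hpos hu.1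
    have hα : 0 ≤ α u := by positivity
    have hAu : A u ≤ A c := norm_kern_antitone ha hb hν hc hu.1
    have hτ : |τ u| ≤ |a.im| * (u ^ 2)⁻¹ + |b.im| * ((u + ν) ^ 2)⁻¹ := by
      refine (abs_add_le _ _).trans_eq ?_
      rw [abs_div, abs_div, abs_of_pos (by positivity : 0 < u ^ 2),
        abs_of_pos (by positivity : 0 < (u + ν) ^ 2), div_eq_mul_inv, div_eq_mul_inv]
    obtain ⟨hP, hD⟩ := hK _ (hmem u) _ (hθ hu.1)
    have n1 : ‖(-(Int.fract u : ℝ) * α u - τ u * D u +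
        α u * phaseCorr (Int.fract u) (kernPhase a b ν u) : ℂ)‖ ≤
        α u + |τ u| * K + α u * K := by
      refine (norm_add_le _ _).trans (add_le_add ((norm_sub_le _ _).trans (add_le_add ?_ ?_)) ?_)
      · rw [norm_mul, norm_neg, Complex.norm_real, Complex.norm_real, Real.norm_eq_abs,
          Real.norm_eq_abs, abs_of_nonneg hα]
        exact mul_le_of_le_one_left hα (abs_fract_le_one u)
      · rw [norm_mul, Complex.norm_real, Real.norm_eq_abs]
        gcongr
      · rw [norm_mul, Complex.norm_real, Real.norm_eq_abs, abs_of_nonneg hα]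
        gcongr
    calc ‖G' u‖ ≤ (α u + |τ u| * K + α u * K) * A u := by
          rw [norm_mul]
          gcongr
      _ = (1 + K) * α u * A u + K * (|τ u| * A u) := by ring
      _ ≤ (1 + K) * α u * A u +
          K * ((|a.im| * (u ^ 2)⁻¹ + |b.im| * ((u + ν) ^ 2)⁻¹) * A c) := by gcongr
      _ = B' u := by simp only [B']; ring
  have hAc : 0 ≤ A c := norm_nonneg _
  have hmain := image_norm_le_of_norm_deriv_right_le_deriv_boundary'
    (f := fun u => G u - G c) (B := fun u => B u - B c) (hGc.sub continuousOn_const)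
    (fun u hu => (hG' u hu).sub_const _) (by simp)
    (fun u hu => ((hBd u hu).sub_const _).continuousAt.continuousWithinAt)
    (fun u hu => ((hBd u (Ico_subset_Icc_self hu)).sub_const _).hasDerivWithinAt) hbound
    (right_mem_Icc.2 hcd)
  have hBdc : B d - B c ≤ (1 + K) * A c + K * A c * ρ := by
    have h1 : |a.im| * c⁻¹ + |b.im| * (c + ν)⁻¹ ≤ ρ := by
      refine le_trans ?_ hab
      rw [add_div, div_eq_mul_inv, div_eq_mul_inv]
      gcongr
      linarith
    have h2 : 0 ≤ |a.im| * d⁻¹ + |b.im| * (d + ν)⁻¹ := by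
      have := hpos hcd
      positivity
    have h3 : 0 ≤ A d := norm_nonneg _
    have h4 : K * A c * (|a.im| * c⁻¹ + |b.im| * (c + ν)⁻¹) ≤ K * A c * ρ := by gcongr
    have h5 : 0 ≤ K * A c * (|a.im| * d⁻¹ + |b.im| * (d + ν)⁻¹) := by positivity
    have h6 : 0 ≤ (1 + K) * A d := by positivity
    simp only [B]
    linarith
  have hsplit : ∫ u in c..d, ((Int.fract u : ℝ) : ℂ) * k' u = (G d - G c) + H d - H c := by
    simp only [G, intervalIntegral.integral_same]
    ring
  have hAd : A d ≤ A c := norm_kern_antitone ha hb hν hc hcd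
  rw [hsplit]
  calc ‖G d - G c + H d - H c‖ ≤ ‖G d - G c‖ + ‖H d‖ + ‖H c‖ :=
        (norm_sub_le _ _).trans (add_le_add_left (norm_add_le _ _) _)
    _ ≤ ((1 + K) * A c + K * A c * ρ) + K * A c + K * A c := by
        refine add_le_add (add_le_add (hmain.trans hBdc) ((hH hcd).trans ?_)) (hH le_rfl)
        gcongr
    _ = _ := by ring

/-- The remainder in Euler's summation formula is of the order of the first term, uniformly in
the phase, as long as the phase turns by less than `2π` between consecutive integers. -/
lemma exists_norm_kernRem_le {ρ : ℝ} (hρ : ρ < 2 * Real.pi) :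
    ∃ K : ℝ, 0 ≤ K ∧ ∀ (a b : ℂ) (ν c : ℝ), 0 ≤ a.re → 0 ≤ b.re → 0 < (a + b).re → 0 ≤ ν →
      0 < c → (|a.im| + |b.im|) / c ≤ ρ → ‖kernRem a b ν c‖ ≤ K * ‖kern a b ν c‖ := by
  obtain ⟨K, hK0, hK⟩ := exists_norm_phaseCorr_le hρ
  refine ⟨2 + 3 * K + K * |ρ|, by positivity, fun a b ν c ha hb hab hν hc hphase => ?_⟩
  have h1 : 1 < (a + 1 + b).re := by
    simp only [Complex.add_re, Complex.one_re] at hab ⊢; linarith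
  have h2 : 1 < (a + (b + 1)).re := by
    simp only [Complex.add_re, Complex.one_re] at hab ⊢; linarith
  have g1 := integrableOn_weight_mul_kern h1 measurable_fract abs_fract_le_one hν hc
  have g2 := integrableOn_weight_mul_kern h2 measurable_fract abs_fract_le_one hν hc
  have hU : ∀ u : ℝ, ((Int.fract u : ℝ) : ℂ) *
      (-a * kern (a + 1) b ν u - b * kern a (b + 1) ν u) =
      -a * ((Int.fract u : ℝ) * kern (a + 1) b ν u) - b * ((Int.fract u : ℝ) * kern a (b + 1) ν u) :=
    fun u => by ring
  have hI : IntegrableOn (fun u : ℝ => ((Int.fract u : ℝ) : ℂ) *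
      (-a * kern (a + 1) b ν u - b * kern a (b + 1) ν u)) (Ioi c) := by
    simp only [hU]
    exact (g1.const_mul _).sub (g2.const_mul _)
  have hval : ∫ u in Ioi c, ((Int.fract u : ℝ) : ℂ) *
      (-a * kern (a + 1) b ν u - b * kern a (b + 1) ν u) =
      -a * kernTail Int.fract (a + 1) b ν c - b * kernTail Int.fract a (b + 1) ν c := by
    simp only [hU]
    rw [integral_sub (g1.const_mul _) (g2.const_mul _), integral_const_mul, integral_const_mul]
    rfl
  have hlim := (intervalIntegral_tendsto_integral_Ioi c hI tendsto_id).norm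
  have hle : ‖∫ u in Ioi c, ((Int.fract u : ℝ) : ℂ) *
      (-a * kern (a + 1) b ν u - b * kern a (b + 1) ν u)‖ ≤
      (1 + 3 * K + K * ρ) * ‖kern a b ν c‖ := by
    refine le_of_tendsto hlim ?_
    filter_upwards [eventually_ge_atTop c] with d hd
    exact norm_integral_fract_mul_deriv_kern_le hρ hK0 hK ha hb hν hc hd hphase
  rw [hval] at hle
  have hf : ‖((Int.fract c : ℝ) : ℂ)‖ ≤ 1 := by
    rw [Complex.norm_real]; exact abs_fract_le_one c
  have hρ' : K * ρ ≤ K * |ρ| := by gcongr; exact le_abs_self ρ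
  calc ‖kernRem a b ν c‖ ≤ ‖((Int.fract c : ℝ) : ℂ)‖ * ‖kern a b ν c‖ +
        (1 + 3 * K + K * ρ) * ‖kern a b ν c‖ := by
        rw [kernRem, ← norm_mul]
        exact (norm_add_le _ _).trans (add_le_add_right hle _)
    _ ≤ 1 * ‖kern a b ν c‖ + (1 + 3 * K + K * |ρ|) * ‖kern a b ν c‖ := by gcongr
    _ = _ := by ring

/-! ### Sums of powers and the shape of the error -/

lemma exists_sum_Ioc_rpow_le {τ : ℝ} (hτ : 0 < τ) (hτ1 : τ ≠ 1) :
    ∃ K : ℝ, 0 ≤ K ∧ ∀ c d : ℝ, 1 ≤ c → c ≤ d →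
      ∑ k ∈ Finset.Ioc ⌊c⌋₊ ⌊d⌋₊, (k : ℝ) ^ (-τ) ≤ K * (c ^ (1 - τ) + d ^ (1 - τ)) := by
  have hne : (τ : ℂ) + 0 ≠ 1 := by simpa using (by exact_mod_cast hτ1 : (τ : ℂ) ≠ 1)
  have h1 : 0 < ‖(τ : ℂ) + 0 - 1‖ := norm_pos_iff.2 (sub_ne_zero.2 hne)
  set δ := min τ ‖(τ : ℂ) + 0 - 1‖
  have hδ : 0 < δ := lt_min hτ h1
  refine ⟨2 ^ (τ + 1) * ((1 + τ / δ) / δ + (1 + 2 * τ / δ)), by positivity,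
    fun c d hc hcd => ?_⟩
  have hb : ∀ e : ℝ, 1 ≤ e → ‖kernSum τ 0 0 e‖ ≤
      2 ^ (τ + 1) * ((1 + τ / δ) / δ + (1 + 2 * τ / δ)) * e ^ (1 - τ) := fun e he => by
    have := norm_kernSum_le (a := τ) (b := 0) (M := τ) hδ (by rw [add_zero, Complex.ofReal_re]; exact min_le_left _ _)
      (min_le_right _ _) (by simp [abs_of_pos hτ]) (by simpa using hτ.le) le_rfl he (by linarith)
    simpa using this
  have hs := sum_kern (a := τ) (b := 0) (by simpa using hτ) hne le_rfl (by linarith) hcd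
  have hk : ∀ k : ℕ, kern τ 0 0 k = (((k : ℝ) ^ (-τ) : ℝ) : ℂ) := fun k => by
    simp only [kern, neg_zero, Complex.cpow_zero, mul_one]
    rw [Complex.ofReal_cpow (Nat.cast_nonneg k)]
    simp
  simp only [hk] at hs
  rw [← Complex.ofReal_sum] at hs
  calc _ ≤ ‖((∑ k ∈ Finset.Ioc ⌊c⌋₊ ⌊d⌋₊, (k : ℝ) ^ (-τ) : ℝ) : ℂ)‖ := by
        rw [Complex.norm_real]; exact Real.le_norm_self _
    _ ≤ _ := by
        rw [hs, mul_add]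
        exact (norm_sub_le _ _).trans (add_le_add (hb c hc) (hb d (hc.trans hcd)))

lemma exists_tsum_rpow_le {τ : ℝ} (hτ : 1 < τ) :
    ∃ K : ℝ, 0 ≤ K ∧ ∀ x : ℝ, 1 ≤ x →
      ∑' n : {n : ℕ // x < n}, ((n : ℕ) : ℝ) ^ (-τ) ≤ K * x ^ (1 - τ) := by
  obtain ⟨K, hK0, hK⟩ := exists_sum_Ioc_rpow_le (by linarith : 0 < τ) hτ.ne'
  refine ⟨2 * K, by positivity, fun x hx => ?_⟩
  have hx0 : 0 < x := by linarith
  rw [show ∑' n : {n : ℕ // x < n}, ((n : ℕ) : ℝ) ^ (-τ) =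
    ∑' n : ℕ, {n : ℕ | x < n}.indicator (fun n : ℕ => (n : ℝ) ^ (-τ)) n from
      tsum_subtype {n : ℕ | x < n} (fun n : ℕ => (n : ℝ) ^ (-τ))]
  refine Real.tsum_le_of_sum_range_le (fun n => indicator_nonneg (fun n _ => by positivity) n)
    fun N => ?_
  have h1 : ∑ n ∈ Finset.range N, {n : ℕ | x < n}.indicator (fun n : ℕ => (n : ℝ) ^ (-τ)) n ≤
      ∑ n ∈ Finset.Ioc ⌊x⌋₊ ⌊max x N⌋₊, (n : ℝ) ^ (-τ) := by
    simp only [indicator_apply]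
    rw [← Finset.sum_filter]
    refine Finset.sum_le_sum_of_subset_of_nonneg (fun n hn => ?_) fun n _ _ => by positivity
    rw [Finset.mem_filter, Finset.mem_range] at hn
    rw [Finset.mem_Ioc]
    refine ⟨(Nat.floor_lt hx0.le).2 hn.2, Nat.le_floor (le_max_of_le_right ?_)⟩
    exact_mod_cast hn.1.le
  have h2 : (max x N) ^ (1 - τ) ≤ x ^ (1 - τ) :=
    Real.rpow_le_rpow_of_nonpos hx0 (le_max_left _ _) (by linarith)
  calc _ ≤ K * (x ^ (1 - τ) + (max x N) ^ (1 - τ)) := h1.trans (hK x _ hx (le_max_left _ _))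
    _ ≤ K * (x ^ (1 - τ) + x ^ (1 - τ)) := by gcongr
    _ = _ := by ring

/-- Separates the size x^(-σ₁-σ₃) of one remainder from `avError 0 σ₂ 0 x`, the order of the sum of
n^(-σ₂) over n ≤ x. -/
lemma avError_eq {σ₁ σ₂ σ₃ x : ℝ} (hx : 0 < x) :
    avError σ₁ σ₂ σ₃ x = x ^ (-σ₁ - σ₃) * avError 0 σ₂ 0 x := by
  simp only [avError, sub_zero, neg_zero, Real.rpow_zero, one_mul]
  split_ifs
  · rw [mul_one]
  · rfl
  · rw [← Real.rpow_add hx]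
    ring_nf

lemma rpow_one_sub_le_avError {σ x : ℝ} (hx : 1 ≤ x) : x ^ (1 - σ) ≤ avError 0 σ 0 x := by
  simp only [avError, sub_zero, neg_zero, Real.rpow_zero, one_mul]
  split_ifs with h1 h2
  · exact Real.rpow_le_one_of_one_le_of_nonpos hx (by linarith)
  · rw [h2, sub_self, Real.rpow_zero]
    linarith [Real.log_nonneg hx]
  · exact le_rfl

lemma exists_sum_rpow_le (σ : ℝ) :
    ∃ K : ℝ, 0 ≤ K ∧ ∀ x : ℝ, 1 ≤ x →
      ∑ n ∈ Finset.Icc 1 ⌊x⌋₊, (n : ℝ) ^ (-σ) ≤ K * avError 0 σ 0 x := by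
  rcases lt_trichotomy σ 1 with hσ | rfl | hσ
  · have he : ∀ x, avError 0 σ 0 x = x ^ (1 - σ) := fun x => by
      simp [avError, not_lt.2 hσ.le, hσ.ne]
    rcases le_or_gt σ 0 with hσ0 | hσ0
    · refine ⟨1, zero_le_one, fun x hx => ?_⟩
      have hx0 : 0 < x := by linarith
      calc _ ≤ ∑ n ∈ Finset.Icc 1 ⌊x⌋₊, x ^ (-σ) := by
            refine Finset.sum_le_sum fun n hn => ?_
            rw [Finset.mem_Icc] at hn
            exact Real.rpow_le_rpow (Nat.cast_nonneg n) ((Nat.le_floor_iff hx0.le).1 hn.2)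
              (by linarith)
        _ = ⌊x⌋₊ * x ^ (-σ) := by simp
        _ ≤ x * x ^ (-σ) := by gcongr; exact Nat.floor_le hx0.le
        _ = _ := by rw [he, one_mul, sub_eq_add_neg, Real.rpow_add hx0, Real.rpow_one]
    -- For 0 < σ < 1 the term n = 1 is split off, because the summation formula from 1 starts at 2.
    · obtain ⟨K, hK0, hK⟩ := exists_sum_Ioc_rpow_le hσ0 hσ.ne
      refine ⟨1 + 2 * K, by positivity, fun x hx => ?_⟩
      have h1 : 1 ≤ x ^ (1 - σ) := Real.one_le_rpow hx (by linarith)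
      have h2 := hK 1 x le_rfl hx
      rw [Nat.floor_one, Real.one_rpow] at h2
      have h3 : 1 ≤ ⌊x⌋₊ := Nat.le_floor (by simpa using hx)
      rw [he, Finset.Icc_eq_cons_Ioc h3, Finset.sum_cons, Nat.cast_one, Real.one_rpow]
      have h4 : K * 1 ≤ K * x ^ (1 - σ) := by gcongr
      linarith
  · refine ⟨1, zero_le_one, fun x hx => ?_⟩
    have h := harmonic_floor_le_one_add_log x hx
    rw [harmonic_eq_sum_Icc] at h
    push_cast at h
    simpa [avError, Real.rpow_neg_one] using h
  · refine ⟨∑' n : ℕ, (n : ℝ) ^ (-σ), tsum_nonneg fun n => by positivity, fun x hx => ?_⟩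
    simp only [avError, hσ, if_true, sub_zero, neg_zero, Real.rpow_zero, mul_one]
    exact (Real.summable_nat_rpow.2 (by linarith)).sum_le_tsum _ fun n _ => by positivity

/-! ### Expansion of the rows and the theorem -/

lemma kern_sub_one_left_self (a b : ℂ) {n : ℕ} (hn : n ≠ 0) :
    kern (a - 1) b n n = 2 ^ (-b) * (n : ℂ) ^ (1 - a - b) := by
  have h0 : (n : ℂ) ≠ 0 := by exact_mod_cast hn
  have h : (n : ℂ) + n = ((2 : ℝ) : ℂ) * ((n : ℝ) : ℂ) := by push_cast; ring
  rw [kern, Complex.ofReal_natCast, h, Complex.mul_cpow_ofReal_nonneg (by norm_num)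
    (Nat.cast_nonneg n), Complex.ofReal_natCast, mul_left_comm, ← Complex.cpow_add _ _ h0]
  push_cast
  ring_nf

lemma natCast_cpow_neg_mul {n : ℕ} (hn : n ≠ 0) (s : ℂ) :
    (n : ℂ) ^ (-s) * n = 1 / (n : ℂ) ^ (s - 1) := by
  have h0 : (n : ℂ) ≠ 0 := by exact_mod_cast hn
  rw [one_div, ← Complex.cpow_neg, neg_sub, sub_eq_add_neg, add_comm, Complex.cpow_add _ _ h0,
    Complex.cpow_one]

/-- For the rows n ≤ x: terms up to `y` are kept, and Euler's formula is applied beyond `y`. -/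
lemma avRow_eq_of_le {s₁ s₂ s₃ : ℂ} (h : 0 < (s₁ + s₃).re) (h1 : s₁ + s₃ ≠ 1) {n : ℕ}
    (hn : n ≠ 0) {y : ℝ} (hy : n ≤ y) :
    avRow (s₁, s₂, s₃) n = ∑ m ∈ Finset.Ioc n ⌊y⌋₊, avTerm s₁ s₂ s₃ m n +
      (y : ℂ) ^ (1 - s₁) / (s₁ + s₃ - 1) * (1 / ((n : ℂ) ^ s₂ * ((y : ℂ) + (n : ℂ)) ^ s₃)) +
      s₃ / (s₁ + s₃ - 1) * (1 / (n : ℂ) ^ (s₂ - 1) * avTail s₁ s₃ n y) +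
      (n : ℂ) ^ (-s₂) * kernRem s₁ s₃ n y := by
  have h2 := sum_kern h h1 (Nat.cast_nonneg n) (by exact_mod_cast Nat.pos_of_ne_zero hn) hy
  rw [Nat.floor_natCast] at h2
  have h3 : kernSum s₁ s₃ n n = ∑ k ∈ Finset.Ioc n ⌊y⌋₊, kern s₁ s₃ n k + kernSum s₁ s₃ n y := by
    rw [h2]; ring
  simp only [avTerm_eq, ← Finset.mul_sum]
  rw [avRow, if_neg hn, h3, kernSum, kernMain, ← avTail_eq, ← natCast_cpow_neg_mul hn, kern,
    one_div, mul_inv, ← Complex.cpow_neg, ← Complex.cpow_neg, Complex.ofReal_natCast, neg_sub]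
  ring

/-- For the rows n > x: Euler's formula is applied at once from n, where u+n = 2n produces the
factor 2^(-s₃). -/
lemma avRow_eq {s₁ s₂ s₃ : ℂ} {n : ℕ} (hn : n ≠ 0) :
    avRow (s₁, s₂, s₃) n =
      2 ^ (-s₃) / (s₁ + s₃ - 1) * (1 / (n : ℂ) ^ (s₁ + s₂ + s₃ - 1)) +
      s₃ / (s₁ + s₃ - 1) * (1 / (n : ℂ) ^ (s₂ - 1) * avTail s₁ s₃ n n) +
      (n : ℂ) ^ (-s₂) * kernRem s₁ s₃ n n := by
  have h0 : (n : ℂ) ≠ 0 := by exact_mod_cast hn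
  have e : 1 / (n : ℂ) ^ (s₁ + s₂ + s₃ - 1) = (n : ℂ) ^ (-s₂) * (n : ℂ) ^ (1 - s₁ - s₃) := by
    rw [one_div, ← Complex.cpow_neg, ← Complex.cpow_add _ _ h0]
    ring_nf
  rw [avRow, if_neg hn, kernSum, kernMain, kern_sub_one_left_self _ _ hn, ← avTail_eq,
    e, ← natCast_cpow_neg_mul hn, Complex.ofReal_natCast]
  ring

theorem theorem2p2 :
    IsAVContinuation (fun s => zetaAV s.1 s.2.1 s.2.2) ∧
    ∀ (s₁ s₂ : ℂ) (σ₃ C : ℝ),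
      0 ≤ s₁.re → max 0 (2 - s₁.re - s₂.re) < σ₃ → 1 < C →
      ∃ K : ℝ, ∀ (s₃ : ℂ) (x y : ℝ),
        s₃.re = σ₃ → s₁ + s₃ ≠ 1 → 1 ≤ x → x ≤ y →
        |s₃.im| ≤ 2 * Real.pi * x / C - |s₁.im| →
        ((0 ≤ s₁.im ∧ 0 ≤ s₃.im) ∨ (s₁.im ≤ 0 ∧ s₃.im ≤ 0)) →
        (s₁.im, s₃.im) ≠ (0, 0) →
        (∀ (n : ℕ) (a : ℝ), 1 ≤ n → 1 ≤ a → IntegrableOn (avKernel s₁ s₃ n) (Ioi a)) ∧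
        Summable (fun n : {n : ℕ // x < n} => 1 / ((n : ℕ) : ℂ) ^ (s₁ + s₂ + s₃ - 1)) ∧
        Summable (fun n : {n : ℕ // x < n} =>
          1 / ((n : ℕ) : ℂ) ^ (s₂ - 1) * avTail s₁ s₃ n (n : ℕ)) ∧
        ‖zetaAV s₁ s₂ s₃ -
            (∑ n ∈ Finset.Icc 1 ⌊x⌋₊, ∑ m ∈ Finset.Ioc n ⌊y⌋₊, avTerm s₁ s₂ s₃ m n
              + (y : ℂ) ^ (1 - s₁) / (s₁ + s₃ - 1) *
                  ∑ n ∈ Finset.Icc 1 ⌊x⌋₊, 1 / ((n : ℂ) ^ s₂ * ((y : ℂ) + (n : ℂ)) ^ s₃)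
              + s₃ / (s₁ + s₃ - 1) *
                  ∑ n ∈ Finset.Icc 1 ⌊x⌋₊, 1 / (n : ℂ) ^ (s₂ - 1) * avTail s₁ s₃ n y
              + 2 ^ (-s₃) / (s₁ + s₃ - 1) *
                  ∑' n : {n : ℕ // x < n}, 1 / ((n : ℕ) : ℂ) ^ (s₁ + s₂ + s₃ - 1)
              + s₃ / (s₁ + s₃ - 1) *
                  ∑' n : {n : ℕ // x < n},
                    1 / ((n : ℕ) : ℂ) ^ (s₂ - 1) * avTail s₁ s₃ n (n : ℕ))‖
          ≤ K * avError s₁.re s₂.re σ₃ x := by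
  refine ⟨isAVContinuation_zetaAV, fun s₁ s₂ σ₃ C hσ₁ hσ₃ hC => ?_⟩
  obtain ⟨hσ₃0, hσ⟩ := max_lt_iff.1 hσ₃
  have hρ : 2 * Real.pi / C < 2 * Real.pi := div_lt_self Real.two_pi_pos hC
  obtain ⟨K₀, hK₀, hrem⟩ := exists_norm_kernRem_le hρ
  obtain ⟨K₁, hK₁, hsum⟩ := exists_sum_rpow_le s₂.re
  obtain ⟨K₂, hK₂, htail⟩ :=
    exists_tsum_rpow_le (by linarith : 1 < s₁.re + s₂.re + σ₃)
  -- `K₀` depends on C alone, `K₁` on σ₂ and `K₂` on σ₁+σ₂+σ₃; all are chosen before s₃, `x`, `y`.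
  -- The two summands serve the rows n ≤ x and n > x.
  refine ⟨K₀ * K₁ + K₀ * K₂, fun s₃ x y hs₃ hne hx hxy hphase _ _ => ?_⟩
  have hC0 : 0 < C := by linarith
  have hx0 : 0 < x := by linarith
  have hre : 0 < (s₁ + s₃).re := by rw [Complex.add_re, hs₃]; linarith
  have hre1 : 1 < (s₁ + (s₃ + 1)).re := by
    simp only [Complex.add_re, Complex.one_re] at hre ⊢; linarith
  have hs : (s₁, s₂, s₃) ∈ avDomain :=
    ⟨by simpa using hre, by simp only [hs₃]; linarith, hne⟩
  -- The hypothesis on t₃ says |t₁|+|t₃| ≤ 2πx/C, so the phase is at most 2π/C at every starting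
  -- point c ≥ x, in particular at c = y and at c = n > x.
  have hph : ∀ c : ℝ, x ≤ c → (|s₁.im| + |s₃.im|) / c ≤ 2 * Real.pi / C := fun c hc => by
    rw [div_le_iff₀ (by linarith)]
    have : 2 * Real.pi * x / C = 2 * Real.pi / C * x := by ring
    have h2 : 2 * Real.pi / C * x ≤ 2 * Real.pi / C * c := by gcongr
    linarith
  have hτ : Summable fun n : {n : ℕ // x < n} => ((n : ℕ) : ℝ) ^ (-(s₁.re + s₂.re + σ₃)) :=
    (Real.summable_nat_rpow.2 (by linarith)).subtype {n : ℕ | x < n}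
  have hτ' : Summable fun n : {n : ℕ // x < n} => ((n : ℕ) : ℝ) ^ (1 - (s₁.re + s₂.re + σ₃)) :=
    (Real.summable_nat_rpow.2 (by linarith)).subtype {n : ℕ | x < n}
  have hS1 : Summable fun n : {n : ℕ // x < n} => 1 / ((n : ℕ) : ℂ) ^ (s₁ + s₂ + s₃ - 1) :=
    (Complex.summable_one_div_nat_cpow.2 (by
      simp only [Complex.sub_re, Complex.add_re, Complex.one_re, hs₃]
      linarith)).subtype {n : ℕ | x < n}
  have hpos : ∀ n : {n : ℕ // x < n}, 0 < (n : ℕ) := fun n => by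
    exact_mod_cast hx0.trans n.2
  have hS2 : Summable fun n : {n : ℕ // x < n} =>
      1 / ((n : ℕ) : ℂ) ^ (s₂ - 1) * avTail s₁ s₃ n (n : ℕ) := by
    refine .of_norm_bounded
      (hτ'.mul_left (2 ^ |(s₃ + 1).re| / ((s₁ + (s₃ + 1)).re - 1))) fun n => ?_
    have hn0 : (0 : ℝ) < (n : ℕ) := by exact_mod_cast hpos n
    have ht := norm_kernTail_le_of_le (sub_pos.2 hre1) (a := s₁) (b := s₃ + 1) (w := fun _ => 1)
      (by linarith) le_rfl (by simp) hn0.le hn0 le_rfl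
    rw [avTail_eq, norm_mul, one_div, ← Complex.cpow_neg,
      Complex.norm_natCast_cpow_of_pos (hpos n)]
    have e : ((n : ℕ) : ℝ) ^ (1 - (s₁.re + s₂.re + σ₃)) =
        ((n : ℕ) : ℝ) ^ (-(s₂ - 1)).re * ((n : ℕ) : ℝ) ^ (1 - (s₁ + (s₃ + 1)).re) := by
      rw [← Real.rpow_add hn0]
      congr 1
      simp [hs₃]
      ring
    rw [e]
    calc _ ≤ ((n : ℕ) : ℝ) ^ (-(s₂ - 1)).re * (2 ^ |(s₃ + 1).re| / ((s₁ + (s₃ + 1)).re - 1) *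
          ((n : ℕ) : ℝ) ^ (1 - (s₁ + (s₃ + 1)).re)) := by gcongr
      _ = _ := by ring
  have hb3 : ∀ n : {n : ℕ // x < n}, ‖((n : ℕ) : ℂ) ^ (-s₂) * kernRem s₁ s₃ (n : ℕ) (n : ℕ)‖ ≤
      K₀ * ((n : ℕ) : ℝ) ^ (-(s₁.re + s₂.re + σ₃)) := fun n => by
    have hn0 : (0 : ℝ) < (n : ℕ) := by exact_mod_cast hpos n
    have h1 := hrem s₁ s₃ (n : ℕ) (n : ℕ) hσ₁ (by rw [hs₃]; exact hσ₃0.le) hre hn0.le hn0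
      (hph _ n.2.le)
    have h2 : ‖kern s₁ s₃ (n : ℕ) (n : ℕ)‖ ≤
        ((n : ℕ) : ℝ) ^ (-s₁.re) * ((n : ℕ) : ℝ) ^ (-σ₃) := by
      rw [norm_kern _ _ hn0 hn0.le, hs₃]
      gcongr ?_ * ?_
      exact Real.rpow_le_rpow_of_nonpos hn0 (by linarith) (by linarith)
    rw [norm_mul, Complex.norm_natCast_cpow_of_pos (hpos n), Complex.neg_re,
      neg_add, neg_add, Real.rpow_add hn0, Real.rpow_add hn0]
    calc _ ≤ ((n : ℕ) : ℝ) ^ (-s₂.re) *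
          (K₀ * (((n : ℕ) : ℝ) ^ (-s₁.re) * ((n : ℕ) : ℝ) ^ (-σ₃))) := by
          gcongr
          exact h1.trans (by gcongr)
      _ = _ := by ring
  have hS3 : Summable fun n : {n : ℕ // x < n} =>
      ((n : ℕ) : ℂ) ^ (-s₂) * kernRem s₁ s₃ (n : ℕ) (n : ℕ) :=
    .of_norm_bounded (hτ.mul_left K₀) hb3
  refine ⟨fun n a _ ha => ?_, hS1, hS2, ?_⟩
  · exact (integrableOn_kern hre1 (Nat.cast_nonneg n) (by linarith)).congr_fun
      (fun u _ => (avKernel_eq s₁ s₃ n u).symm) measurableSet_Ioi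
  have hsplit : zetaAV s₁ s₂ s₃ = ∑ n ∈ Finset.Icc 1 ⌊x⌋₊, avRow (s₁, s₂, s₃) n +
      ∑' n : {n : ℕ // x < n}, avRow (s₁, s₂, s₃) n := by
    have hcompl : ((Finset.range (⌊x⌋₊ + 1) : Set ℕ)ᶜ) = {n : ℕ | x < n} := by
      ext n
      simp [Nat.floor_lt hx0.le]
    have h1 := (hasSum_avRow hs).summable.sum_add_tsum_compl (s := Finset.range (⌊x⌋₊ + 1))
    rw [hcompl, (hasSum_avRow hs).tsum_eq] at h1
    rw [← h1]
    congr 1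
    refine (Finset.sum_subset (fun n hn => ?_) fun n hn hn' => ?_).symm
    · rw [Finset.mem_Icc] at hn
      rw [Finset.mem_range]
      omega
    · rw [Finset.mem_range] at hn
      rw [Finset.mem_Icc] at hn'
      rw [avRow, if_pos (by omega)]
  -- All explicit terms match row by row, which leaves exactly the Euler remainders.
  have hmain : zetaAV s₁ s₂ s₃ -
            (∑ n ∈ Finset.Icc 1 ⌊x⌋₊, ∑ m ∈ Finset.Ioc n ⌊y⌋₊, avTerm s₁ s₂ s₃ m n
              + (y : ℂ) ^ (1 - s₁) / (s₁ + s₃ - 1) *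
                  ∑ n ∈ Finset.Icc 1 ⌊x⌋₊, 1 / ((n : ℂ) ^ s₂ * ((y : ℂ) + (n : ℂ)) ^ s₃)
              + s₃ / (s₁ + s₃ - 1) *
                  ∑ n ∈ Finset.Icc 1 ⌊x⌋₊, 1 / (n : ℂ) ^ (s₂ - 1) * avTail s₁ s₃ n y
              + 2 ^ (-s₃) / (s₁ + s₃ - 1) *
                  ∑' n : {n : ℕ // x < n}, 1 / ((n : ℕ) : ℂ) ^ (s₁ + s₂ + s₃ - 1)
              + s₃ / (s₁ + s₃ - 1) *
                  ∑' n : {n : ℕ // x < n},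
                    1 / ((n : ℕ) : ℂ) ^ (s₂ - 1) * avTail s₁ s₃ n (n : ℕ)) =
      ∑ n ∈ Finset.Icc 1 ⌊x⌋₊, (n : ℂ) ^ (-s₂) * kernRem s₁ s₃ n y +
      ∑' n : {n : ℕ // x < n}, ((n : ℕ) : ℂ) ^ (-s₂) * kernRem s₁ s₃ (n : ℕ) (n : ℕ) := by
    have h1 : ∑ n ∈ Finset.Icc 1 ⌊x⌋₊, avRow (s₁, s₂, s₃) n = ∑ n ∈ Finset.Icc 1 ⌊x⌋₊,
        (∑ m ∈ Finset.Ioc n ⌊y⌋₊, avTerm s₁ s₂ s₃ m n +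
          (y : ℂ) ^ (1 - s₁) / (s₁ + s₃ - 1) * (1 / ((n : ℂ) ^ s₂ * ((y : ℂ) + (n : ℂ)) ^ s₃)) +
          s₃ / (s₁ + s₃ - 1) * (1 / (n : ℂ) ^ (s₂ - 1) * avTail s₁ s₃ n y) +
          (n : ℂ) ^ (-s₂) * kernRem s₁ s₃ n y) :=
      Finset.sum_congr rfl fun n hn => by
        rw [Finset.mem_Icc] at hn
        exact avRow_eq_of_le hre hne (by omega)
          (((Nat.le_floor_iff hx0.le).1 hn.2).trans hxy)
    have h2 : ∑' n : {n : ℕ // x < n}, avRow (s₁, s₂, s₃) n = _ :=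
      tsum_congr fun n => avRow_eq (hpos n).ne'
    rw [hsplit, h1, h2, ((hS1.mul_left _).add (hS2.mul_left _)).tsum_add hS3,
      (hS1.mul_left _).tsum_add (hS2.mul_left _), tsum_mul_left, tsum_mul_left,
      Finset.sum_add_distrib, Finset.sum_add_distrib, Finset.sum_add_distrib,
      ← Finset.mul_sum, ← Finset.mul_sum]
    ring
  have hb1 : ‖∑ n ∈ Finset.Icc 1 ⌊x⌋₊, (n : ℂ) ^ (-s₂) * kernRem s₁ s₃ n y‖ ≤
      K₀ * x ^ (-s₁.re - σ₃) * ∑ n ∈ Finset.Icc 1 ⌊x⌋₊, (n : ℝ) ^ (-s₂.re) := by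
    rw [Finset.mul_sum]
    refine norm_sum_le_of_le _ fun n hn => ?_
    rw [Finset.mem_Icc] at hn
    have hy0 : 0 < y := by linarith
    have h1 := hrem s₁ s₃ n y hσ₁ (by rw [hs₃]; exact hσ₃0.le) hre (Nat.cast_nonneg n) hy0
      (hph _ hxy)
    have h2 : ‖kern s₁ s₃ n y‖ ≤ x ^ (-s₁.re - σ₃) := by
      rw [norm_kern _ _ hy0 (Nat.cast_nonneg n), hs₃, sub_eq_add_neg, Real.rpow_add hx0]
      have h3 : x ≤ y + n := by linarith [(Nat.cast_nonneg n : (0 : ℝ) ≤ n)]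
      exact mul_le_mul (Real.rpow_le_rpow_of_nonpos hx0 hxy (by linarith))
        (Real.rpow_le_rpow_of_nonpos hx0 h3 (by linarith)) (by positivity) (by positivity)
    rw [norm_mul, Complex.norm_natCast_cpow_of_pos (by omega), Complex.neg_re]
    calc _ ≤ (n : ℝ) ^ (-s₂.re) * (K₀ * x ^ (-s₁.re - σ₃)) := by
          gcongr
          exact h1.trans (by gcongr)
      _ = _ := by ring
  have hb2 : ‖∑' n : {n : ℕ // x < n}, ((n : ℕ) : ℂ) ^ (-s₂) * kernRem s₁ s₃ (n : ℕ) (n : ℕ)‖ ≤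
      K₀ * ∑' n : {n : ℕ // x < n}, ((n : ℕ) : ℝ) ^ (-(s₁.re + s₂.re + σ₃)) :=
    tsum_of_norm_bounded (hτ.hasSum.mul_left K₀) hb3
  have hsplit_rpow : x ^ (1 - (s₁.re + s₂.re + σ₃)) = x ^ (-s₁.re - σ₃) * x ^ (1 - s₂.re) := by
    rw [← Real.rpow_add hx0]
    ring_nf
  rw [hmain, avError_eq hx0]
  calc _ ≤ K₀ * x ^ (-s₁.re - σ₃) * ∑ n ∈ Finset.Icc 1 ⌊x⌋₊, (n : ℝ) ^ (-s₂.re) +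
        K₀ * ∑' n : {n : ℕ // x < n}, ((n : ℕ) : ℝ) ^ (-(s₁.re + s₂.re + σ₃)) :=
        (norm_add_le _ _).trans (add_le_add hb1 hb2)
    _ ≤ K₀ * x ^ (-s₁.re - σ₃) * (K₁ * avError 0 s₂.re 0 x) +
        K₀ * (K₂ * (x ^ (-s₁.re - σ₃) * avError 0 s₂.re 0 x)) := by
        refine add_le_add (by gcongr; exact hsum x hx) ?_
        refine mul_le_mul_of_nonneg_left ((htail x hx).trans ?_) hK₀
        rw [hsplit_rpow]
        gcongr
        exact rpow_one_sub_le_avError hx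
    _ = _ := by ring
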